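/- All systems are finite-dimensional, logarithms are to base $2$, and $H(\rho)=-\operatorname{Tr}\{\rho\log\rho\}$. Let $\mathcal{S}$ be a finite set of parties. For every $\mathcal{K}\subseteq\mathcal{S}$ with $|\mathcal{K}|\geq 2$, let $\Phi_{\mathcal{K}}$ be a GHZ state shared by the parties in $\mathcal{K}$, i.e. $|\Phi\rangle=\frac{1}{\sqrt{d}}\sum_{i=0}^{d-1}\bigotimes_{a\in\mathcal{K}}|i\rangle_a$ with Schmidt rank $d=d_{\mathcal{K}}\geq 1$, and put $E_{\mathcal{K}}=\log d_{\mathcal{K}}$. Let $\gamma_{\mathcal{K}}$ be a private state of $K_{\mathcal{K}}=\log k_{\mathcal{K}}$ private bits ($k_{\mathcal{K}}\geq 1$) shared by the parties in $\mathcal{K}$: each party holds a $k_{\mathcal{K}}$-dimensional key system and a shield system of arbitrary finite dimension, and $$\gamma_{\mathcal{K}}=U\,(\Phi\otimes\rho)\,U^{\dagger},\qquad U=\sum_{i}|i\rangle\langle i|\otimes U^{i},$$ where $\Phi$ is the GHZ state of Schmidt rank $k_{\mathcal{K}}$ of the key systems, $\rho$ is an arbitrary state of the shield systems, $i=(i_a)_{a\in\mathcal{K}}$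 runs over the product basis of the key systems, and each $U^{i}$ is an arbitrary unitary on the joint shield system. Let $$\Psi_{\mathcal{S}}=\bigotimes_{\mathcal{K}\subseteq\mathcal{S},\,|\mathcal{K}|\geq2}\Phi_{\mathcal{K}}\otimes\gamma_{\mathcal{K}},$$ where distinct tensor factors act on distinct subsystems of the parties. For a partition $\mathcal{G}$ of $\mathcal{S}$ and a state $\omega$ of the systems of the parties in $\mathcal{S}$ and of a further system $E$, write $H(\mathcal{X}|E)=H(\mathcal{X}E)_\omega-H(E)_\omega$ for $\mathcal{X}\subseteq\mathcal{S}$ and $$I(\mathcal{G}|E)_\omega=\sum_{\mathcal{X}\in\mathcal{G}}H(\mathcal{X}|E)-H(\mathcal{S}|E),\qquad \widetilde{I}(\mathcal{G}|E)_\omega=\sum_{\mathcal{X}\in\mathcal{G}}H(\mathcal{S}\setminus\mathcal{X}|E)-(|\mathcal{G}|-1)H(\mathcal{S}|E).$$ The multipartite squashed entanglements of a state $\rho$ of the systems of the parties in $\mathcal{S}$, grouped according to $\mathcal{G}$, are $$E_{\mathrm{sq}}(\mathcal{G})_\rho=\tfrac12\inf_\omega I(\mathcal{G}|E)_\omega,\qquad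 \widetilde{E}_{\mathrm{sq}}(\mathcal{G})_\rho=\tfrac12\inf_\omega\widetilde{I}(\mathcal{G}|E)_\omega,$$ where the infima run over all states $\omega$ with $\operatorname{Tr}_E\omega=\rho$ and all (finite) dimensions of $E$. Let $\mathcal{C}(\mathcal{G})$ be the set of all $\mathcal{M}\subseteq\mathcal{S}$ with $|\mathcal{M}|\geq2$ that are not contained in a single element of $\mathcal{G}$, and let $\mathcal{A}(\mathcal{M},\mathcal{G})=\{\mathcal{X}\cap\mathcal{M}\mid\mathcal{X}\in\mathcal{G}\}\setminus\{\emptyset\}$. Then for every nontrivial partition $\mathcal{G}\neq\{\mathcal{S}\}$ of $\mathcal{S}$, $$\frac12\sum_{\mathcal{M}\in\mathcal{C}(\mathcal{G})}|\mathcal{A}(\mathcal{M},\mathcal{G})|\,(K_{\mathcal{M}}+E_{\mathcal{M}})\;\leq\;\min\left\{E_{\mathrm{sq}}(\mathcal{G})_{\Psi_{\mathcal{S}}},\ \widetilde{E}_{\mathrm{sq}}(\mathcal{G})_{\Psi_{\mathcal{S}}}\right\}.$$ -/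

import Mathlib

open scoped Kronecker ComplexOrder Matrix

noncomputable section

namespace Squashed

/-- Density operators (quantum states) on the finite-dimensional Hilbert space with orthonormal
basis indexed by `ι`. -/
structure IsState {ι : Type*} [Fintype ι] (ρ : Matrix ι ι ℂ) : Prop where
  posSemidef : ρ.PosSemidef
  trace_eq_one : ρ.trace = 1

/-- The von Neumann entropy `H(ρ) = -Tr (ρ log₂ ρ)`, with the logarithm taken by functional calculus
(and the convention `0 log 0 = 0`). -/
def entropy {ι : Type*} [Fintype ι] [DecidableEq ι] (ρ : Matrix ι ι ℂ) : ℝ :=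
  -((ρ * cfc (Real.logb 2) ρ).trace).re

/-- In terms of eigenvalues, the von Neumann entropy is the Shannon entropy of the spectrum. -/
theorem entropy_eq_sum_eigenvalues {ι : Type*} [Fintype ι] [DecidableEq ι] {ρ : Matrix ι ι ℂ}
    (h : ρ.IsHermitian) :
    entropy ρ = -∑ i, h.eigenvalues i * Real.logb 2 (h.eigenvalues i) := by
  have hmul : ρ * cfc (Real.logb 2) ρ = cfc (fun x : ℝ => x * Real.logb 2 x) ρ := by
    have hf : (spectrum ℝ ρ).Finite := Set.toFinite _
    rw [cfc_mul (fun x : ℝ => x) (Real.logb 2) ρ (hf.continuousOn _) (hf.continuousOn _)]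
    congr 1
    exact (cfc_id' ℝ ρ h).symm
  rw [entropy, hmul, h.cfc_eq, Matrix.IsHermitian.cfc, Unitary.conjStarAlgAut_apply,
    Matrix.trace_mul_cycle, Unitary.coe_star_mul_self, one_mul, Matrix.trace_diagonal]
  simp

section Multipartite

/-! A multipartite system: the parties are the elements of `S`, and `H a` is the index set of an
orthonormal basis of the Hilbert space of the party `a`, so that `(a : S) → H a` indexes the product
basis of the joint Hilbert space. A further system `E` has basis index set `E`. -/

variable {S : Type*} [Fintype S] [DecidableEq S] {H : S → Type*} [∀ a, Fintype (H a)]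
  [∀ a, DecidableEq (H a)] {E : Type*} [Fintype E] [DecidableEq E]

/-- The basis index of the joint system with components `x` on the parties in `X` and `z` on the
others. -/
def glue (X : Finset S) (x : (a : {a // a ∈ X}) → H a) (z : (a : {a // a ∉ X}) → H a) :
    (a : S) → H a :=
  fun a => if h : a ∈ X then x ⟨a, h⟩ else z ⟨a, h⟩

/-- The reduced operator on the systems of the parties in `X` together with `E`: the partial trace
over the systems of all parties outside `X`. For `X = ∅` it is the reduced operator on `E`. -/
def reduced (ω : Matrix (((a : S) → H a) × E) (((a : S) → H a) × E) ℂ) (X : Finset S) :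
    Matrix (((a : {a // a ∈ X}) → H a) × E) (((a : {a // a ∈ X}) → H a) × E) ℂ :=
  Matrix.of fun p q =>
    ∑ z : (a : {a // a ∉ X}) → H a, ω (glue X p.1 z, p.2) (glue X q.1 z, q.2)

/-- The conditional entropy `H(X|E) = H(XE) - H(E)`. -/
def condEntropy (ω : Matrix (((a : S) → H a) × E) (((a : S) → H a) × E) ℂ) (X : Finset S) : ℝ :=
  entropy (reduced ω X) - entropy (reduced ω ∅)

/-- The conditional multipartite information `I(𝒢|E)`, the parties being grouped according to the
partition `𝒢` of `S`: the sum of `H(X|E)` over the blocks `X`, minus `H(S|E)`. -/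
def condInfo (G : Finpartition (Finset.univ : Finset S))
    (ω : Matrix (((a : S) → H a) × E) (((a : S) → H a) × E) ℂ) : ℝ :=
  ∑ X ∈ G.parts, condEntropy ω X - condEntropy ω Finset.univ

/-- The conditional multipartite information `Ĩ(𝒢|E)`, the parties being grouped according to the
partition `𝒢` of `S`: the sum of `H(S∖X|E)` over the blocks `X`, minus `(|𝒢| - 1) H(S|E)`. -/
def condInfoTilde (G : Finpartition (Finset.univ : Finset S))
    (ω : Matrix (((a : S) → H a) × E) (((a : S) → H a) × E) ℂ) : ℝ :=
  ∑ X ∈ G.parts, condEntropy ω (Finset.univ \ X)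
    - ((G.parts.card : ℝ) - 1) * condEntropy ω Finset.univ

/-- `ω` is an extension of `ρ`: a state of the parties together with `E` whose partial trace over
`E` is `ρ`. -/
structure IsExtension (ρ : Matrix ((a : S) → H a) ((a : S) → H a) ℂ)
    (ω : Matrix (((a : S) → H a) × E) (((a : S) → H a) × E) ℂ) : Prop where
  isState : IsState ω
  trace_E : ∀ x y, ∑ e, ω (x, e) (y, e) = ρ x y

/-- The multipartite squashed entanglement `E_sq(𝒢)_ρ`, the infimum running over all extensions
of `ρ` by a system `E` of arbitrary finite dimension. -/
def squashed (G : Finpartition (Finset.univ : Finset S))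
    (ρ : Matrix ((a : S) → H a) ((a : S) → H a) ℂ) : ℝ :=
  1 / 2 * sInf {r : ℝ | ∃ (n : ℕ)
    (ω : Matrix (((a : S) → H a) × Fin n) (((a : S) → H a) × Fin n) ℂ),
    IsExtension ρ ω ∧ r = condInfo G ω}

/-- The multipartite squashed entanglement `Ẽ_sq(𝒢)_ρ`, the infimum running over all extensions
of `ρ` by a system `E` of arbitrary finite dimension. -/
def squashedTilde (G : Finpartition (Finset.univ : Finset S))
    (ρ : Matrix ((a : S) → H a) ((a : S) → H a) ℂ) : ℝ :=
  1 / 2 * sInf {r : ℝ | ∃ (n : ℕ)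
    (ω : Matrix (((a : S) → H a) × Fin n) (((a : S) → H a) × Fin n) ℂ),
    IsExtension ρ ω ∧ r = condInfoTilde G ω}

end Multipartite

section States

/-- The vector `d^{-1/2} ∑ᵢ ⨂_{a ∈ P} |i⟩_a` of the GHZ state of Schmidt rank `d`. -/
def ghzVector (P : Type*) [Fintype P] (d : ℕ) : (P → Fin d) → ℂ :=
  fun x => ((1 / Real.sqrt d : ℝ) : ℂ) * ∑ i : Fin d, ∏ a, (Pi.single i 1 : Fin d → ℂ) (x a)

/-- The GHZ state `Φ_P = |Φ⟩⟨Φ|` of Schmidt rank `d` shared by the parties in `P`. -/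
def ghz (P : Type*) [Fintype P] (d : ℕ) : Matrix (P → Fin d) (P → Fin d) ℂ :=
  Matrix.vecMulVec (ghzVector P d) (star (ghzVector P d))

/-- The controlled unitary `∑ᵢ |i⟩⟨i| ⊗ Uⁱ`, with control index set `ι`. -/
def twisting {ι σ : Type*} [DecidableEq ι] (U : ι → Matrix σ σ ℂ) : Matrix (ι × σ) (ι × σ) ℂ :=
  Matrix.of fun p q => if p.1 = q.1 then U p.1 p.2 q.2 else 0

/-- `γ` is a private state of `log₂ k` private bits of the parties in `P`: the party `a` holds a key
system of dimension `k` and a shield system of dimension `s a`, and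
`γ = U (Φ ⊗ ρ) U†` with `Φ` the GHZ state of Schmidt rank `k` of the key systems, `ρ` a state of
the shield systems, and `U` a twisting unitary, controlled by the key systems. -/
def IsPrivate {P : Type*} [Fintype P] [DecidableEq P] (k : ℕ) (s : P → ℕ)
    (γ : Matrix ((P → Fin k) × ((a : P) → Fin (s a))) ((P → Fin k) × ((a : P) → Fin (s a))) ℂ) :
    Prop :=
  ∃ (ρ : Matrix ((a : P) → Fin (s a)) ((a : P) → Fin (s a)) ℂ)
    (U : (P → Fin k) → Matrix ((a : P) → Fin (s a)) ((a : P) → Fin (s a)) ℂ),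
    IsState ρ ∧ (∀ i, U i ∈ Matrix.unitaryGroup ((a : P) → Fin (s a)) ℂ) ∧
    γ = twisting U * (ghz P k ⊗ₖ ρ) * (twisting U)ᴴ

variable {S : Type*} [Fintype S] [DecidableEq S]

/-- The basis index set of the party `a` in the state `Ψ_S`: for each set `K` of at least two
parties with `a ∈ K`, the party holds a system of dimension `d K` of a GHZ state, a key system of
dimension `k K` and a shield system of dimension `s K a`. -/
abbrev PartyIndex (d k : Finset S → ℕ) (s : Finset S → S → ℕ) (a : S) : Type _ :=
  (K : {K : Finset S // a ∈ K ∧ 2 ≤ K.card}) → Fin (d K) × Fin (k K) × Fin (s K a)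

/-- The state `Ψ_S = ⨂_K Φ_K ⊗ γ_K`, with `K` ranging over the sets of at least two parties, where
`Φ_K` is the GHZ state of Schmidt rank `d K` and distinct tensor factors act on distinct
subsystems of the parties. -/
def bigState (d k : Finset S → ℕ) (s : Finset S → S → ℕ)
    (γ : (K : Finset S) → Matrix (({a // a ∈ K} → Fin (k K)) × ((a : {a // a ∈ K}) → Fin (s K a)))
      (({a // a ∈ K} → Fin (k K)) × ((a : {a // a ∈ K}) → Fin (s K a))) ℂ) :
    Matrix ((a : S) → PartyIndex d k s a) ((a : S) → PartyIndex d k s a) ℂ :=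
  Matrix.of fun x y => ∏ K : {K : Finset S // 2 ≤ K.card},
    ghz {a // a ∈ K.1} (d K)
      (fun a => (x a ⟨K, a.2, K.2⟩).1) (fun a => (y a ⟨K, a.2, K.2⟩).1) *
    γ K (fun a => (x a ⟨K, a.2, K.2⟩).2.1, fun a => (x a ⟨K, a.2, K.2⟩).2.2)
      (fun a => (y a ⟨K, a.2, K.2⟩).2.1, fun a => (y a ⟨K, a.2, K.2⟩).2.2)

/-- The family `𝒞(𝒢)` of the sets of at least two parties that are not contained in a single block
of the partition `𝒢`. -/
def crossing (G : Finpartition (Finset.univ : Finset S)) : Finset (Finset S) :=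
  Finset.univ.filter fun M => 2 ≤ M.card ∧ ∀ X ∈ G.parts, ¬ M ⊆ X

/-- The family `𝒜(M, 𝒢) = {X ∩ M | X ∈ 𝒢} ∖ {∅}`. -/
def traceBlocks (M : Finset S) (G : Finpartition (Finset.univ : Finset S)) : Finset (Finset S) :=
  (G.parts.image fun X => X ∩ M).erase ∅

end States

end Squashed

end

/-!
For a set `Y` of parties, let `f(Y) = H(YE)` for an extension `ω` of `Ψ_S`. The bound combines two
facts.

*Without keys the informations are nonnegative.* The function `f` is submodular, which is strong
subadditivity of the von Neumann entropy, and telescoping over the blocks of the partition gives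
`I(𝒢|E) ≥ 0` and `Ĩ(𝒢|E) ≥ 0` (`condInfo_nonneg`, `condInfoTilde_nonneg`). Strong subadditivity
(`strong_subadditivity`) comes from monotonicity of the relative entropy under partial trace
(`relativeEntropy_traceRight_le`), applied to `ρ_ABC` and `1 ⊗ (ρ_BC + ε)`. The monotonicity is
elementary: up to terms in `Tr ρ`, `D(ρ‖σ)` is an integral over `t > 0` of suprema over `Z` of
`2 Re Tr ρZ - t Tr ZρZ† - Tr Z†σZ`; each of these forms is linear in `(ρ, σ)` and, at `Z ⊗ 1`, only
depends on the marginals, so restricting the supremum to such `Z` gives the inequality for every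
`t` (`resolventForm_kronecker_one`).

*Measuring a key costs `log N` in every reduction that splits it.* The factor `Φ_M ⊗ γ_M` is
`N⁻¹ W ρ W†`, where `N = d_M k_M` and `W = ∑ᵢ |i…i⟩ ⊗ Uⁱ`. The projection `q = N⁻¹ W W†` fixes it,
hence its lift fixes every extension `ω` (`IsExtension.slotOp_mul`). Let `ωᵢ` be the state after all
parties in `M` have found the key value `i`. If `M ∩ Y = ∅`, then `ωᵢ` and `ω` have the same
reduction to `YE`; if `M ⊆ Y`, they are related by a local isometry; and otherwise the reduction of
`ω` is the uniform mixture of the mutually orthogonal reductions of the `ωᵢ`. So `f` of `ω` is the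
average of `f` of the `ωᵢ`, plus `log N` in the last case (`IsKeyProjection.entropy_reduced`).
For a crossing set `M`, neither `∅` nor `S` splits `M`, while a block `X` splits `M` if and only if
`S ∖ X` does, if and only if `X` meets `M`. Hence measuring the key of `M` lowers both informations
by exactly `|𝒜(M, 𝒢)| log N` on average.

The other factors are not disturbed by the measurement, so the crossing sets can be treated one
after the other (`sum_le_of_measured`), and what remains at the end is nonnegative.
-/

noncomputable section

namespace Squashed

set_option linter.unusedSectionVars false

/-! ### Entropy as the trace of a polynomial -/

section Entropy

variable {m n ι : Type*} [Fintype m] [DecidableEq m] [Fintype n] [DecidableEq n] [Fintype ι]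

theorem entropy_eq_trace_cfc {A : Matrix n n ℂ} (hA : A.IsHermitian) :
    entropy A = -(cfc (fun x : ℝ => x * Real.logb 2 x) A).trace.re := by
  have hf : (spectrum ℝ A).Finite := Set.toFinite _
  have hid : cfc (fun x : ℝ => x) A = A := cfc_id' ℝ A hA
  rw [entropy, cfc_mul (fun x : ℝ => x) (Real.logb 2) A (hf.continuousOn _) (hf.continuousOn _),
    hid]

theorem entropy_eq_trace_aeval {A : Matrix n n ℂ} (hA : A.IsHermitian) {p : Polynomial ℝ}
    (hp : ∀ x ∈ spectrum ℝ A, p.eval x = x * Real.logb 2 x) :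
    entropy A = -(Polynomial.aeval A p).trace.re := by
  rw [entropy_eq_trace_cfc hA, ← cfc_polynomial p A hA]
  congr 3
  exact cfc_congr fun x hx => (hp x hx).symm

/-- On finitely many points, `x log x` is a polynomial without constant term. So the entropies of
finitely many operators are traces of a common such polynomial, to which the cyclicity of the trace
and orthogonality relations apply. -/
theorem exists_polynomial_eq_mul_logb {s : Set ℝ} (hs : s.Finite) :
    ∃ q : Polynomial ℝ, ∀ x ∈ s, (Polynomial.X * q).eval x = x * Real.logb 2 x := by
  classical
  refine ⟨Lagrange.interpolate hs.toFinset id (Real.logb 2), fun x hx => ?_⟩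
  have := Lagrange.eval_interpolate_at_node (s := hs.toFinset) (v := id) (Real.logb 2)
    (Function.injective_id.injOn) (i := x) (by simpa using hx)
  simp only [id] at this
  rw [Polynomial.eval_mul, Polynomial.eval_X, this]

theorem mul_aeval_mul_comm (A : Matrix m n ℂ) (B : Matrix n m ℂ) (q : Polynomial ℝ) :
    B * Polynomial.aeval (A * B) q = Polynomial.aeval (B * A) q * B := by
  induction q using Polynomial.induction_on' with
  | add p q hp hq => simp [Matrix.mul_add, Matrix.add_mul, hp, hq]
  | monomial k a =>
    have : ∀ k : ℕ, B * (A * B) ^ k = (B * A) ^ k * B := by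
      intro k
      induction k with
      | zero => simp
      | succ k ih => rw [pow_succ, ← Matrix.mul_assoc, ih, pow_succ]; simp only [Matrix.mul_assoc]
    simp only [Polynomial.aeval_monomial, Algebra.algebraMap_eq_smul_one, smul_mul_assoc, one_mul]
    rw [Matrix.mul_smul, Matrix.smul_mul, this]

/-- `AB` and `BA` have the same nonzero spectrum, hence the same entropy. -/
theorem entropy_mul_comm {A : Matrix m n ℂ} {B : Matrix n m ℂ} (h₁ : (A * B).IsHermitian)
    (h₂ : (B * A).IsHermitian) : entropy (A * B) = entropy (B * A) := by
  obtain ⟨q, hq⟩ := exists_polynomial_eq_mul_logb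
    ((Set.toFinite (spectrum ℝ (A * B))).union (Set.toFinite (spectrum ℝ (B * A))))
  rw [entropy_eq_trace_aeval h₁ fun x hx => hq x (Or.inl hx),
    entropy_eq_trace_aeval h₂ fun x hx => hq x (Or.inr hx)]
  simp only [map_mul, Polynomial.aeval_X]
  rw [Matrix.mul_assoc, mul_aeval_mul_comm, ← Matrix.mul_assoc, Matrix.trace_mul_comm,
    ← Matrix.mul_assoc, Matrix.trace_mul_comm, ← Matrix.mul_assoc]

theorem entropy_submatrix_equiv {A : Matrix n n ℂ} (hA : A.IsHermitian) (e : m ≃ n) :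
    entropy (A.submatrix e e) = entropy A := by
  have h1 : A.submatrix e e = (A.submatrix e id) * ((1 : Matrix n n ℂ).submatrix id e) := by
    ext i j; simp [Matrix.mul_apply, Matrix.one_apply]
  have h2 : ((1 : Matrix n n ℂ).submatrix id e) * (A.submatrix e id) = A := by
    ext i j
    rw [Matrix.mul_apply]
    refine (e.sum_comp (fun x => (1 : Matrix n n ℂ) i x * A x j)).trans ?_
    simp [Matrix.one_apply]
  rw [h1, entropy_mul_comm (by rw [← h1]; exact hA.submatrix e) (by rw [h2]; exact hA), h2]

/-- Conjugation by an operator that is isometric on the support does not change the entropy. -/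
theorem entropy_conj_isometry {A : Matrix n n ℂ} (hA : A.IsHermitian) {V : Matrix m n ℂ}
    (hV : Vᴴ * V * A = A) : entropy (V * A * Vᴴ) = entropy A := by
  have h2 : Vᴴ * (V * A) = A := by rw [← Matrix.mul_assoc, hV]
  rw [entropy_mul_comm (Matrix.isHermitian_mul_mul_conjTranspose _ hA) (by rw [h2]; exact hA), h2]

/-- For operators that need not be normalised, the entropy is additive over orthogonal sums. -/
theorem entropy_sum_of_orthogonal [DecidableEq ι] {A : ι → Matrix n n ℂ}
    (hA : ∀ i, (A i).IsHermitian)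
    (horth : ∀ i j, i ≠ j → A i * A j = 0) : entropy (∑ i, A i) = ∑ i, entropy (A i) := by
  have hsum : (∑ i, A i).IsHermitian := by
    simp only [Matrix.IsHermitian, Matrix.conjTranspose_sum, fun i => (hA i).eq]
  obtain ⟨q, hq⟩ := exists_polynomial_eq_mul_logb
    ((Set.toFinite (spectrum ℝ (∑ i, A i))).union
      (Set.finite_iUnion fun i => Set.toFinite (spectrum ℝ (A i))))
  rw [entropy_eq_trace_aeval hsum fun x hx => hq x (Or.inl hx)]
  simp_rw [fun i => entropy_eq_trace_aeval (hA i) fun x hx =>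
    hq x (Or.inr (Set.mem_iUnion.2 ⟨i, hx⟩))]
  have hpow : ∀ k : ℕ, (∑ i, A i) ^ (k + 1) = ∑ i, A i ^ (k + 1) := by
    intro k
    induction k with
    | zero => simp
    | succ k ih =>
      rw [pow_succ, ih, Finset.sum_mul]
      refine Finset.sum_congr rfl fun i _ => ?_
      rw [Finset.mul_sum, Finset.sum_eq_single i, ← pow_succ]
      · intro j _ hj
        rw [pow_succ, mul_assoc, horth i j hj.symm, mul_zero]
      · simp
  have key : ∀ q : Polynomial ℝ, Polynomial.aeval (∑ i, A i) (Polynomial.X * q)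
      = ∑ i, Polynomial.aeval (A i) (Polynomial.X * q) := by
    intro q
    induction q using Polynomial.induction_on' with
    | add p q hp hq => simp only [mul_add, map_add, hp, hq, Finset.sum_add_distrib]
    | monomial k a =>
      simp only [Polynomial.X_mul_monomial, Polynomial.aeval_monomial, hpow, Finset.mul_sum]
  rw [key, Matrix.trace_sum, Complex.re_sum, Finset.sum_neg_distrib]

theorem entropy_smul {A : Matrix n n ℂ} (hA : A.IsHermitian) {c : ℝ} (hc : 0 < c) :
    entropy (c • A) = c * entropy A - c * Real.logb 2 c * A.trace.re := by
  have hf : (spectrum ℝ A).Finite := Set.toFinite _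
  have hf' : (((c • ·) : ℝ → ℝ) '' spectrum ℝ A).Finite := hf.image _
  have hcA : (c • A).IsHermitian := by
    rw [Matrix.IsHermitian, Matrix.conjTranspose_smul, hA.eq, star_trivial]
  have hcomp : cfc (fun x : ℝ => (c • x) * Real.logb 2 (c • x)) A
      = cfc (fun x : ℝ => x * Real.logb 2 x) (c • A) :=
    cfc_comp_smul c (fun x : ℝ => x * Real.logb 2 x) A (hf'.continuousOn _) hA
  have hid : cfc (fun x : ℝ => x) A = A := cfc_id' ℝ A hA
  rw [entropy_eq_trace_cfc hcA, entropy_eq_trace_cfc hA, ← hcomp]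
  have : ∀ x : ℝ, (c • x) * Real.logb 2 (c • x)
      = c • (x * Real.logb 2 x) + (c * Real.logb 2 c) • x := by
    intro x
    rcases eq_or_ne x 0 with rfl | hx
    · simp
    · simp only [smul_eq_mul]
      rw [Real.logb_mul hc.ne' hx]; ring
  simp_rw [this]
  rw [cfc_add (R := ℝ) (a := A) _ _ (hf.continuousOn _) (hf.continuousOn _),
    cfc_smul c _ A (hf.continuousOn _), cfc_smul (c * Real.logb 2 c) _ A (hf.continuousOn _),
    hid]
  simp [Matrix.trace_add, Matrix.trace_smul]
  ring

/-- The entropy of a uniform mixture of `N` mutually orthogonal states exceeds the average entropy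
by `log N`. -/
theorem entropy_uniform_mixture [DecidableEq ι] [Nonempty ι] {A : ι → Matrix n n ℂ}
    (hA : ∀ i, (A i).IsHermitian) (htr : ∀ i, (A i).trace = 1)
    (horth : ∀ i j, i ≠ j → A i * A j = 0) :
    entropy (∑ i, (Fintype.card ι : ℝ)⁻¹ • A i)
      = Real.logb 2 (Fintype.card ι) + (Fintype.card ι : ℝ)⁻¹ * ∑ i, entropy (A i) := by
  have hN : (0 : ℝ) < Fintype.card ι := by exact_mod_cast Fintype.card_pos
  rw [entropy_sum_of_orthogonal]
  · simp_rw [fun i => entropy_smul (hA i) (inv_pos.2 hN), htr, Finset.sum_sub_distrib,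
      ← Finset.mul_sum]
    simp [Real.logb_inv]
    field_simp
    ring
  · intro i
    rw [Matrix.IsHermitian, Matrix.conjTranspose_smul, (hA i).eq, star_trivial]
  · intro i j hij
    rw [smul_mul_smul_comm, horth i j hij, smul_zero]

end Entropy

/-! ### Monotonicity of the relative entropy under partial trace -/

section RelativeEntropy

open Filter Topology

/-- The resolvent representation `p log (p/s) = ∫₀^∞ (p²/(tp + s) - p/(1 + t)) dt`, used to compare
two weighted sums: a pointwise inequality of the integrands gives the inequality of the sums. -/
theorem sum_mul_log_sub_log_le {ι κ : Type*} [Fintype ι] [Fintype κ]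
    {c p s : ι → ℝ} {c' p' s' : κ → ℝ} (hp : ∀ i, 0 ≤ p i) (hs : ∀ i, 0 < s i)
    (hp' : ∀ i, 0 ≤ p' i) (hs' : ∀ i, 0 < s' i)
    (hle : ∀ t, 0 ≤ t →
      ∑ i, c' i * (p' i ^ 2 / (t * p' i + s' i)) ≤ ∑ i, c i * (p i ^ 2 / (t * p i + s i)))
    (htr : ∑ i, c' i * p' i = ∑ i, c i * p i) :
    ∑ i, c' i * (p' i * (Real.log (p' i) - Real.log (s' i)))
      ≤ ∑ i, c i * (p i * (Real.log (p i) - Real.log (s i))) := by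
  have hderiv : ∀ {p s t : ℝ}, 0 ≤ p → 0 < s → 0 ≤ t →
      HasDerivAt (fun t => p * (Real.log (t * p + s) - Real.log s)) (p ^ 2 / (t * p + s)) t := by
    intro p s t hp hs ht
    have h0 : 0 < t * p + s := by positivity
    have h1 : HasDerivAt (fun t : ℝ => t * p + s) p t := by
      simpa using ((hasDerivAt_id t).mul_const p).add_const s
    have h2 := ((h1.log h0.ne').sub_const (Real.log s)).const_mul p
    exact h2.congr_deriv (by ring)
  set g : ℝ → ℝ := fun t => ∑ i, c i * (p i * (Real.log (t * p i + s i) - Real.log (s i)))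
    - ∑ i, c' i * (p' i * (Real.log (t * p' i + s' i) - Real.log (s' i))) with hg
  have hgd : ∀ t, 0 ≤ t → HasDerivAt g (∑ i, c i * (p i ^ 2 / (t * p i + s i))
      - ∑ i, c' i * (p' i ^ 2 / (t * p' i + s' i))) t := by
    intro t ht
    refine HasDerivAt.fun_sub ?_ ?_
    · exact HasDerivAt.fun_sum fun i _ => (hderiv (hp i) (hs i) ht).const_mul _
    · exact HasDerivAt.fun_sum fun i _ => (hderiv (hp' i) (hs' i) ht).const_mul _
  have hmono : MonotoneOn g (Set.Ici 0) := by
    refine monotoneOn_of_deriv_nonneg (convex_Ici 0)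
      (fun t ht => (hgd t ht).continuousAt.continuousWithinAt) (fun t ht => ?_) (fun t ht => ?_)
    · rw [interior_Ici] at ht
      exact (hgd t ht.le).differentiableAt.differentiableWithinAt
    · rw [interior_Ici] at ht
      rw [(hgd t ht.le).deriv]
      exact sub_nonneg.2 (hle t ht.le)
  have hg0 : g 0 = 0 := by simp [hg]
  have hgT : ∀ T, 0 ≤ T → 0 ≤ g T := fun T hT => hg0 ▸ hmono (Set.self_mem_Ici) hT hT
  -- dividing by `T` inside the logarithm costs `log T` times the common total weight
  have hlog : ∀ {p s T : ℝ}, 0 ≤ p → 0 < s → 0 < T →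
      p * (Real.log (T * p + s) - Real.log s)
        = p * (Real.log (p + s * T⁻¹) - Real.log s) + p * Real.log T := by
    intro p s T hp hs hT
    have : T * p + s = (p + s * T⁻¹) * T := by field_simp
    rw [this, Real.log_mul (by positivity) hT.ne']
    ring
  have hfin : ∀ T, 0 < T →
      ∑ i, c' i * (p' i * (Real.log (p' i + s' i * T⁻¹) - Real.log (s' i)))
        ≤ ∑ i, c i * (p i * (Real.log (p i + s i * T⁻¹) - Real.log (s i))) := by
    intro T hT
    have h := hgT T hT.le
    simp only [hg, fun i => hlog (hp i) (hs i) hT, fun i => hlog (hp' i) (hs' i) hT, mul_add,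
      Finset.sum_add_distrib] at h
    simp only [← mul_assoc, ← Finset.sum_mul, htr] at h
    simp only [← mul_assoc]
    linarith
  have hlim : ∀ {p s : ℝ}, 0 ≤ p → 0 < s →
      Tendsto (fun T : ℝ => p * (Real.log (p + s * T⁻¹) - Real.log s)) atTop
        (𝓝 (p * (Real.log p - Real.log s))) := by
    intro p s hp hs
    rcases hp.eq_or_lt with rfl | hp
    · simp
    · have h1 : Tendsto (fun T : ℝ => p + s * T⁻¹) atTop (𝓝 (p + s * 0)) :=
        tendsto_const_nhds.add (tendsto_inv_atTop_zero.const_mul s)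
      rw [mul_zero, add_zero] at h1
      exact ((h1.log hp.ne').sub_const _).const_mul _
  refine le_of_tendsto_of_tendsto
    (tendsto_finsetSum _ fun i _ => (hlim (hp' i) (hs' i)).const_mul (c' i))
    (tendsto_finsetSum _ fun i _ => (hlim (hp i) (hs i)).const_mul (c i)) ?_
  filter_upwards [eventually_gt_atTop 0] with T hT using hfin T hT

variable {m n : Type*} [Fintype m] [DecidableEq m] [Fintype n] [DecidableEq n]

/-- The partial trace over the second tensor factor. -/
def traceRight (ρ : Matrix (m × n) (m × n) ℂ) : Matrix m m ℂ :=
  Matrix.of fun i j => ∑ k, ρ (i, k) (j, k)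

theorem trace_traceRight (ρ : Matrix (m × n) (m × n) ℂ) : (traceRight ρ).trace = ρ.trace := by
  simp [traceRight, Matrix.trace, Fintype.sum_prod_type]

theorem traceRight_mul_kronecker_one (ρ : Matrix (m × n) (m × n) ℂ) (X : Matrix m m ℂ) :
    traceRight (ρ * (X ⊗ₖ 1)) = traceRight ρ * X := by
  ext i j
  simp only [traceRight, Matrix.of_apply, Matrix.mul_apply, Fintype.sum_prod_type,
    Matrix.kroneckerMap_apply, Matrix.one_apply, mul_ite, mul_one, mul_zero,
    Finset.sum_ite_eq', Finset.mem_univ, if_true, Finset.sum_mul]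
  rw [Finset.sum_comm]

theorem traceRight_kronecker_one_mul (ρ : Matrix (m × n) (m × n) ℂ) (X : Matrix m m ℂ) :
    traceRight ((X ⊗ₖ 1) * ρ) = X * traceRight ρ := by
  ext i j
  simp only [traceRight, Matrix.of_apply, Matrix.mul_apply, Fintype.sum_prod_type,
    Matrix.kroneckerMap_apply, Matrix.one_apply, mul_ite, mul_one, mul_zero, ite_mul, zero_mul,
    Finset.sum_ite_eq, Finset.mem_univ, if_true, Finset.mul_sum]
  rw [Finset.sum_comm]

/-- The partial trace is cyclic for operators on the factor that is traced out. -/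
theorem traceRight_one_kronecker_mul_comm (ρ : Matrix (m × n) (m × n) ℂ) (X : Matrix n n ℂ) :
    traceRight (((1 : Matrix m m ℂ) ⊗ₖ X) * ρ) = traceRight (ρ * ((1 : Matrix m m ℂ) ⊗ₖ X)) := by
  ext i j
  simp only [traceRight, Matrix.of_apply, Matrix.mul_apply, Fintype.sum_prod_type_right,
    Matrix.kroneckerMap_apply, Matrix.one_apply, mul_ite, mul_zero, ite_mul, zero_mul,
    one_mul, Finset.sum_ite_eq, Finset.sum_ite_eq', Finset.mem_univ, if_true]
  rw [Finset.sum_comm]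
  simp only [mul_comm]

theorem traceRight_posSemidef {ρ : Matrix (m × n) (m × n) ℂ} (h : ρ.PosSemidef) :
    (traceRight ρ).PosSemidef := by
  have : traceRight ρ = ∑ k, ρ.submatrix (fun i => (i, k)) (fun i => (i, k)) := by
    ext i j; simp [traceRight, Matrix.sum_apply]
  rw [this]
  exact Matrix.posSemidef_sum _ fun k _ => h.submatrix _

/-- The quadratic functional of `Z` whose supremum is the resolvent form
`⟨√ρ, (t + L_σ R_ρ⁻¹)⁻¹ √ρ⟩` of the relative modular operator. -/
def resolventForm (t : ℝ) (ρ σ Z : Matrix n n ℂ) : ℝ :=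
  2 * (ρ * Z).trace.re - t * (Z * ρ * Zᴴ).trace.re - (Zᴴ * σ * Z).trace.re

/-- The form is linear in `(ρ, σ)`, so on `Z ⊗ 1` it only sees the marginals. -/
theorem resolventForm_kronecker_one (t : ℝ) (ρ σ : Matrix (m × n) (m × n) ℂ) (Z : Matrix m m ℂ) :
    resolventForm t ρ σ (Z ⊗ₖ 1) = resolventForm t (traceRight ρ) (traceRight σ) Z := by
  have hZ : (Z ⊗ₖ (1 : Matrix n n ℂ))ᴴ = Zᴴ ⊗ₖ 1 := by
    rw [Matrix.conjTranspose_kronecker, Matrix.conjTranspose_one]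
  simp only [resolventForm, hZ]
  simp only [← trace_traceRight (n := n), traceRight_mul_kronecker_one,
    traceRight_kronecker_one_mul]

/-- In eigenbases of `ρ` and `σ` the form decouples into scalar quadratics. -/
theorem resolventForm_eq_sum {ρ σ U W : Matrix n n ℂ} {p s : n → ℝ}
    (hU : Uᴴ * U = 1) (hW : Wᴴ * W = 1)
    (hρ : ρ = U * Matrix.diagonal (fun i => (p i : ℂ)) * Uᴴ)
    (hσ : σ = W * Matrix.diagonal (fun i => (s i : ℂ)) * Wᴴ) (t : ℝ) (z : Matrix n n ℂ) :
    resolventForm t ρ σ (W * z * Uᴴ) = ∑ x : n × n,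
      (2 * p x.1 * ((Uᴴ * W) x.1 x.2 * z x.2 x.1).re
        - (t * p x.1 + s x.2) * Complex.normSq (z x.2 x.1)) := by
  set P := Matrix.diagonal (fun i => (p i : ℂ))
  set D := Matrix.diagonal (fun i => (s i : ℂ))
  have h1 : (ρ * (W * z * Uᴴ)).trace = (P * ((Uᴴ * W) * z)).trace := by
    rw [hρ, ← Matrix.mul_assoc, Matrix.trace_mul_comm]
    simp only [← Matrix.mul_assoc, hU, Matrix.one_mul]
  have h2 : ((W * z * Uᴴ) * ρ * (W * z * Uᴴ)ᴴ).trace = (z * (P * zᴴ)).trace := by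
    have : (W * z * Uᴴ) * ρ * (W * z * Uᴴ)ᴴ
        = W * (z * (Uᴴ * U) * P * (Uᴴ * U) * zᴴ * Wᴴ) := by
      simp only [hρ, Matrix.conjTranspose_mul, Matrix.conjTranspose_conjTranspose,
        Matrix.mul_assoc]
    rw [this, Matrix.trace_mul_comm, hU, Matrix.mul_assoc _ Wᴴ, hW]
    simp only [Matrix.mul_one, Matrix.mul_assoc]
  have h3 : ((W * z * Uᴴ)ᴴ * σ * (W * z * Uᴴ)).trace = (zᴴ * (D * z)).trace := by
    have : (W * z * Uᴴ)ᴴ * σ * (W * z * Uᴴ)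
        = U * (zᴴ * (Wᴴ * W) * D * (Wᴴ * W) * z * Uᴴ) := by
      simp only [hσ, Matrix.conjTranspose_mul, Matrix.conjTranspose_conjTranspose,
        Matrix.mul_assoc]
    rw [this, Matrix.trace_mul_comm, hW, Matrix.mul_assoc _ Uᴴ, hU]
    simp only [Matrix.mul_one, Matrix.mul_assoc]
  have e1 : (P * ((Uᴴ * W) * z)).trace.re
      = ∑ x : n × n, p x.1 * ((Uᴴ * W) x.1 x.2 * z x.2 x.1).re := by
    simp only [P, Matrix.trace, Matrix.diag_apply, Matrix.diagonal_mul, Complex.re_sum,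
      Complex.re_ofReal_mul, Fintype.sum_prod_type]
    refine Finset.sum_congr rfl fun i _ => ?_
    rw [Matrix.mul_apply, Complex.re_sum, Finset.mul_sum]
  have e2 : (z * (P * zᴴ)).trace.re = ∑ x : n × n, p x.1 * Complex.normSq (z x.2 x.1) := by
    simp only [P, Matrix.trace, Matrix.diag_apply, Complex.re_sum, Matrix.mul_apply (M := z),
      Fintype.sum_prod_type_right, Matrix.diagonal_mul, Matrix.conjTranspose_apply]
    refine Finset.sum_congr rfl fun i _ => Finset.sum_congr rfl fun j _ => ?_
    simp [Complex.normSq_apply]; ring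
  have e3 : (zᴴ * (D * z)).trace.re = ∑ x : n × n, s x.2 * Complex.normSq (z x.2 x.1) := by
    simp only [D, Matrix.trace, Matrix.diag_apply, Complex.re_sum, Matrix.mul_apply (M := zᴴ),
      Fintype.sum_prod_type, Matrix.diagonal_mul, Matrix.conjTranspose_apply]
    refine Finset.sum_congr rfl fun i _ => Finset.sum_congr rfl fun j _ => ?_
    simp [Complex.normSq_apply]; ring
  rw [resolventForm, h1, h2, h3, e1, e2, e3, Finset.mul_sum, Finset.mul_sum,
    ← Finset.sum_sub_distrib, ← Finset.sum_sub_distrib]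
  refine Finset.sum_congr rfl fun x _ => ?_
  ring

/-- The maximum of the form over `Z`, found by completing the square in each scalar quadratic. -/
theorem resolventForm_le {ρ σ U W : Matrix n n ℂ} {p s : n → ℝ}
    (hU : Uᴴ * U = 1) (hW : Wᴴ * W = 1)
    (hρ : ρ = U * Matrix.diagonal (fun i => (p i : ℂ)) * Uᴴ)
    (hσ : σ = W * Matrix.diagonal (fun i => (s i : ℂ)) * Wᴴ)
    (hp : ∀ i, 0 ≤ p i) (hs : ∀ i, 0 < s i) {t : ℝ} (ht : 0 ≤ t) (Z : Matrix n n ℂ) :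
    resolventForm t ρ σ Z ≤ ∑ x : n × n,
      Complex.normSq ((Uᴴ * W) x.1 x.2) * (p x.1 ^ 2 / (t * p x.1 + s x.2)) := by
  have hU' : U * Uᴴ = 1 := mul_eq_one_comm.1 hU
  have hW' : W * Wᴴ = 1 := mul_eq_one_comm.1 hW
  have hZ : Z = W * (Wᴴ * Z * U) * Uᴴ := by
    calc Z = (W * Wᴴ) * Z * (U * Uᴴ) := by rw [hU', hW', Matrix.one_mul, Matrix.mul_one]
      _ = _ := by simp only [Matrix.mul_assoc]
  rw [hZ, resolventForm_eq_sum hU hW hρ hσ]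
  refine Finset.sum_le_sum fun x _ => ?_
  generalize (Uᴴ * W) x.1 x.2 = a
  generalize (Wᴴ * Z * U) x.2 x.1 = z
  have hq : 0 < t * p x.1 + s x.2 := by have := hp x.1; have := hs x.2; positivity
  rw [← mul_div_assoc, le_div_iff₀ hq]
  simp only [Complex.normSq_apply, Complex.mul_re]
  nlinarith [sq_nonneg ((t * p x.1 + s x.2) * z.re - p x.1 * a.re),
    sq_nonneg ((t * p x.1 + s x.2) * z.im + p x.1 * a.im)]

/-- The maximum in `resolventForm_le` is attained. -/
theorem exists_resolventForm_eq {ρ σ U W : Matrix n n ℂ} {p s : n → ℝ}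
    (hU : Uᴴ * U = 1) (hW : Wᴴ * W = 1)
    (hρ : ρ = U * Matrix.diagonal (fun i => (p i : ℂ)) * Uᴴ)
    (hσ : σ = W * Matrix.diagonal (fun i => (s i : ℂ)) * Wᴴ)
    (hp : ∀ i, 0 ≤ p i) (hs : ∀ i, 0 < s i) {t : ℝ} (ht : 0 ≤ t) :
    ∃ Z, resolventForm t ρ σ Z = ∑ x : n × n,
      Complex.normSq ((Uᴴ * W) x.1 x.2) * (p x.1 ^ 2 / (t * p x.1 + s x.2)) := by
  refine ⟨W * (Matrix.of fun j i =>
    ((p i / (t * p i + s j) : ℝ) : ℂ) * star ((Uᴴ * W) i j)) * Uᴴ, ?_⟩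
  rw [resolventForm_eq_sum hU hW hρ hσ]
  refine Finset.sum_congr rfl fun x _ => ?_
  simp only [Matrix.of_apply]
  generalize (Uᴴ * W) x.1 x.2 = a
  have hq : 0 < t * p x.1 + s x.2 := by have := hp x.1; have := hs x.2; positivity
  have h1 : (a * (((p x.1 / (t * p x.1 + s x.2) : ℝ) : ℂ) * star a)).re
      = p x.1 / (t * p x.1 + s x.2) * Complex.normSq a := by
    rw [mul_left_comm, Complex.re_ofReal_mul]
    simp [Complex.normSq_apply]
  rw [h1, Complex.normSq_mul, Complex.normSq_ofReal]
  have : Complex.normSq (star a) = Complex.normSq a := Complex.normSq_conj a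
  rw [this]
  field_simp
  ring

theorem sum_normSq_row {U W : Matrix n n ℂ} (hU : Uᴴ * U = 1) (hW : Wᴴ * W = 1) (i : n) :
    ∑ j, Complex.normSq ((Uᴴ * W) i j) = 1 := by
  have h : (Uᴴ * W) * (Uᴴ * W)ᴴ = 1 := by
    rw [Matrix.conjTranspose_mul, Matrix.conjTranspose_conjTranspose, Matrix.mul_assoc,
      ← Matrix.mul_assoc W, mul_eq_one_comm.1 hW, Matrix.one_mul, hU]
  have h2 := congrFun (congrFun h i) i
  rw [Matrix.mul_apply, Matrix.one_apply_eq] at h2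
  have h3 := congrArg Complex.re h2
  simpa [Complex.normSq_apply] using h3

/-- The scalar double sum in eigenbases is `Tr ρ log ρ - Tr ρ log σ`. -/
theorem sum_normSq_mul_log_sub_log {ρ U W : Matrix n n ℂ} {p s : n → ℝ}
    (hU : Uᴴ * U = 1) (hW : Wᴴ * W = 1)
    (hρ : ρ = U * Matrix.diagonal (fun i => (p i : ℂ)) * Uᴴ) :
    ∑ x : n × n, Complex.normSq ((Uᴴ * W) x.1 x.2)
        * (p x.1 * (Real.log (p x.1) - Real.log (s x.2)))
      = ∑ i, p i * Real.log (p i)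
        - (ρ * (W * Matrix.diagonal (fun i => (Real.log (s i) : ℂ)) * Wᴴ)).trace.re := by
  have htr : (ρ * (W * Matrix.diagonal (fun i => (Real.log (s i) : ℂ)) * Wᴴ)).trace.re
      = ∑ x : n × n, Complex.normSq ((Uᴴ * W) x.1 x.2) * (p x.1 * Real.log (s x.2)) := by
    have : (ρ * (W * Matrix.diagonal (fun i => (Real.log (s i) : ℂ)) * Wᴴ)).trace
      = (Matrix.diagonal (fun i => (p i : ℂ)) * ((Uᴴ * W)
          * (Matrix.diagonal (fun i => (Real.log (s i) : ℂ)) * (Uᴴ * W)ᴴ))).trace := by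
      rw [hρ, Matrix.mul_assoc, Matrix.mul_assoc, Matrix.trace_mul_comm]
      simp only [Matrix.mul_assoc, Matrix.conjTranspose_mul, Matrix.conjTranspose_conjTranspose]
    rw [this]
    simp only [Matrix.trace, Matrix.diag_apply, Matrix.diagonal_mul, Complex.re_sum,
      Complex.re_ofReal_mul, Fintype.sum_prod_type]
    refine Finset.sum_congr rfl fun i _ => ?_
    rw [Matrix.mul_apply, Complex.re_sum, Finset.mul_sum]
    refine Finset.sum_congr rfl fun j _ => ?_
    rw [Matrix.diagonal_mul, Matrix.conjTranspose_apply]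
    generalize (Uᴴ * W) i j = a
    simp [Complex.normSq_apply]; ring
  rw [htr]
  simp only [mul_sub, Finset.sum_sub_distrib]
  congr 1
  rw [Fintype.sum_prod_type]
  refine Finset.sum_congr rfl fun i _ => ?_
  simp only
  rw [← Finset.sum_mul, sum_normSq_row hU hW, one_mul]

theorem trace_eq_sum_normSq {ρ U W : Matrix n n ℂ} {p : n → ℝ}
    (hU : Uᴴ * U = 1) (hW : Wᴴ * W = 1)
    (hρ : ρ = U * Matrix.diagonal (fun i => (p i : ℂ)) * Uᴴ) :
    ∑ x : n × n, Complex.normSq ((Uᴴ * W) x.1 x.2) * p x.1 = ρ.trace.re := by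
  rw [hρ, Matrix.trace_mul_comm, ← Matrix.mul_assoc, hU, Matrix.one_mul, Fintype.sum_prod_type]
  simp [← Finset.sum_mul, sum_normSq_row hU hW, Matrix.trace]

/-- **Monotonicity of the relative entropy** `Tr ρ (log ρ - log σ)` under partial trace, in terms of
spectral decompositions of the four operators involved. -/
theorem relativeEntropy_traceRight_le {ρ σ U W : Matrix (m × n) (m × n) ℂ} {U' W' : Matrix m m ℂ}
    {p s : m × n → ℝ} {p' s' : m → ℝ}
    (hU : Uᴴ * U = 1) (hW : Wᴴ * W = 1) (hU' : U'ᴴ * U' = 1) (hW' : W'ᴴ * W' = 1)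
    (hρ : ρ = U * Matrix.diagonal (fun i => (p i : ℂ)) * Uᴴ)
    (hσ : σ = W * Matrix.diagonal (fun i => (s i : ℂ)) * Wᴴ)
    (hρ' : traceRight ρ = U' * Matrix.diagonal (fun i => (p' i : ℂ)) * U'ᴴ)
    (hσ' : traceRight σ = W' * Matrix.diagonal (fun i => (s' i : ℂ)) * W'ᴴ)
    (hp : ∀ i, 0 ≤ p i) (hs : ∀ i, 0 < s i) (hp' : ∀ i, 0 ≤ p' i) (hs' : ∀ i, 0 < s' i) :
    ∑ i, p' i * Real.log (p' i)
        - (traceRight ρ * (W' * Matrix.diagonal (fun i => (Real.log (s' i) : ℂ)) * W'ᴴ)).trace.re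
      ≤ ∑ i, p i * Real.log (p i)
        - (ρ * (W * Matrix.diagonal (fun i => (Real.log (s i) : ℂ)) * Wᴴ)).trace.re := by
  rw [← sum_normSq_mul_log_sub_log hU hW hρ, ← sum_normSq_mul_log_sub_log hU' hW' hρ']
  refine sum_mul_log_sub_log_le (fun x => hp x.1) (fun x => hs x.2) (fun x => hp' x.1)
    (fun x => hs' x.2) (fun t ht => ?_) ?_
  · obtain ⟨Z, hZ⟩ := exists_resolventForm_eq hU' hW' hρ' hσ' hp' hs' ht
    rw [← hZ, ← resolventForm_kronecker_one]
    exact resolventForm_le hU hW hρ hσ hp hs ht _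
  · rw [trace_eq_sum_normSq hU hW hρ, trace_eq_sum_normSq hU' hW' hρ', trace_traceRight]

end RelativeEntropy

/-! ### Strong subadditivity -/

section StrongSubadditivity

open Filter Topology

variable {α β γ n : Type*} [Fintype α] [DecidableEq α] [Fintype β] [DecidableEq β]
  [Fintype γ] [DecidableEq γ] [Fintype n] [DecidableEq n]

theorem exists_spectral_decomposition {A : Matrix n n ℂ} (hA : A.PosSemidef) :
    ∃ (U : Matrix n n ℂ) (p : n → ℝ), Uᴴ * U = 1 ∧ (∀ i, 0 ≤ p i) ∧
      A = U * Matrix.diagonal (fun i => (p i : ℂ)) * Uᴴ ∧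
      ∑ i, p i * Real.log (p i) = -(entropy A * Real.log 2) := by
  refine ⟨hA.1.eigenvectorUnitary, hA.1.eigenvalues, ?_, hA.eigenvalues_nonneg, ?_, ?_⟩
  · exact Unitary.coe_star_mul_self _
  · have h := hA.1.spectral_theorem
    rw [Unitary.conjStarAlgAut_apply] at h
    exact h
  · rw [entropy_eq_sum_eigenvalues hA.1, neg_mul, neg_neg, Finset.sum_mul]
    refine Finset.sum_congr rfl fun i _ => ?_
    have : Real.log 2 ≠ 0 := (Real.log_pos one_lt_two).ne'
    rw [Real.logb]
    field_simp

/-- The partial trace over the first factor `α` of `α × γ × β`. -/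
def traceFirst (ρ : Matrix ((α × γ) × β) ((α × γ) × β) ℂ) : Matrix (γ × β) (γ × β) ℂ :=
  Matrix.of fun q r => ∑ a, ρ ((a, q.1), q.2) ((a, r.1), r.2)

theorem traceFirst_posSemidef {ρ : Matrix ((α × γ) × β) ((α × γ) × β) ℂ} (h : ρ.PosSemidef) :
    (traceFirst ρ).PosSemidef := by
  have : traceFirst ρ = ∑ a, ρ.submatrix (fun q : γ × β => ((a, q.1), q.2))
      (fun q : γ × β => ((a, q.1), q.2)) := by
    ext i j; simp [traceFirst, Matrix.sum_apply]
  rw [this]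
  exact Matrix.posSemidef_sum _ fun k _ => h.submatrix _

/-- The operator `1 ⊗ X` on `α × γ × β`. -/
def oneFirst (α : Type*) [Fintype α] [DecidableEq α] (X : Matrix (γ × β) (γ × β) ℂ) :
    Matrix ((α × γ) × β) ((α × γ) × β) ℂ :=
  ((1 : Matrix α α ℂ) ⊗ₖ X).submatrix (Equiv.prodAssoc α γ β) (Equiv.prodAssoc α γ β)

theorem oneFirst_apply (X : Matrix (γ × β) (γ × β) ℂ) (p q : (α × γ) × β) :
    oneFirst α X p q = if p.1.1 = q.1.1 then X (p.1.2, p.2) (q.1.2, q.2) else 0 := by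
  simp [oneFirst, Matrix.one_apply]

theorem oneFirst_mul (X Y : Matrix (γ × β) (γ × β) ℂ) :
    oneFirst α (X * Y) = oneFirst α X * oneFirst α Y := by
  rw [oneFirst, oneFirst, oneFirst, Matrix.submatrix_mul_equiv, ← Matrix.mul_kronecker_mul,
    Matrix.one_mul]

theorem oneFirst_conjTranspose (X : Matrix (γ × β) (γ × β) ℂ) :
    oneFirst α Xᴴ = (oneFirst α X)ᴴ := by
  rw [oneFirst, oneFirst, Matrix.conjTranspose_submatrix, Matrix.conjTranspose_kronecker,
    Matrix.conjTranspose_one]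

theorem oneFirst_one : oneFirst α (1 : Matrix (γ × β) (γ × β) ℂ) = 1 := by
  rw [oneFirst, Matrix.one_kronecker_one, Matrix.submatrix_one_equiv]

theorem oneFirst_diagonal (f : γ × β → ℂ) :
    oneFirst α (Matrix.diagonal f) = Matrix.diagonal (fun i => f (i.1.2, i.2)) := by
  ext ⟨⟨a, c⟩, b⟩ ⟨⟨a', c'⟩, b'⟩
  by_cases h : a = a' <;> simp [oneFirst_apply, Matrix.diagonal_apply, h]

theorem trace_mul_oneFirst (ρ : Matrix ((α × γ) × β) ((α × γ) × β) ℂ)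
    (X : Matrix (γ × β) (γ × β) ℂ) : (ρ * oneFirst α X).trace = (traceFirst ρ * X).trace := by
  have h : ∀ p : (α × γ) × β, (ρ * oneFirst α X) p p
      = ∑ q : γ × β, ρ p ((p.1.1, q.1), q.2) * X q (p.1.2, p.2) := by
    intro p
    rw [Matrix.mul_apply, Fintype.sum_prod_type, Fintype.sum_prod_type,
      Finset.sum_eq_single p.1.1, Fintype.sum_prod_type]
    · simp [oneFirst_apply]
    · intro a _ ha
      simp [oneFirst_apply, ha]
    · simp
  simp only [Matrix.trace, Matrix.diag_apply, h, Matrix.mul_apply, traceFirst, Matrix.of_apply,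
    Finset.sum_mul]
  rw [Fintype.sum_prod_type, Fintype.sum_prod_type, Fintype.sum_prod_type, Finset.sum_comm]
  refine Finset.sum_congr rfl fun c _ => ?_
  rw [Finset.sum_comm]
  refine Finset.sum_congr rfl fun b _ => ?_
  rw [Finset.sum_comm]

theorem oneFirst_kronecker_one (X : Matrix γ γ ℂ) :
    oneFirst α (X ⊗ₖ (1 : Matrix β β ℂ)) = ((1 : Matrix α α ℂ) ⊗ₖ X) ⊗ₖ 1 := by
  ext p q
  by_cases h : p.2 = q.2 <;> simp [oneFirst_apply, Matrix.one_apply, h]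

theorem trace_traceRight_mul_one_kronecker (ρ : Matrix ((α × γ) × β) ((α × γ) × β) ℂ)
    (X : Matrix γ γ ℂ) : (traceRight ρ * ((1 : Matrix α α ℂ) ⊗ₖ X)).trace
      = (traceRight (traceFirst ρ) * X).trace := by
  rw [← traceRight_mul_kronecker_one, trace_traceRight, ← oneFirst_kronecker_one,
    trace_mul_oneFirst, ← traceRight_mul_kronecker_one, trace_traceRight]

theorem traceRight_oneFirst (X : Matrix (γ × β) (γ × β) ℂ) :
    traceRight (oneFirst α X) = (1 : Matrix α α ℂ) ⊗ₖ traceRight X := by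
  ext p q
  by_cases h : p.1 = q.1 <;> simp [oneFirst_apply, traceRight, Matrix.one_apply, h]

theorem trace_mul_conj_diagonal {V : Matrix n n ℂ} (hV : Vᴴ * V = 1) (r l : n → ℝ) :
    (V * Matrix.diagonal (fun i => (r i : ℂ)) * Vᴴ
      * (V * Matrix.diagonal (fun i => (l i : ℂ)) * Vᴴ)).trace.re = ∑ i, r i * l i := by
  have : V * Matrix.diagonal (fun i => (r i : ℂ)) * Vᴴ
      * (V * Matrix.diagonal (fun i => (l i : ℂ)) * Vᴴ)
      = V * (Matrix.diagonal (fun i => (r i : ℂ)) * (Vᴴ * V)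
        * Matrix.diagonal (fun i => (l i : ℂ)) * Vᴴ) := by
    simp only [Matrix.mul_assoc]
  rw [this, Matrix.trace_mul_comm, hV, Matrix.mul_assoc _ Vᴴ, hV]
  simp [Matrix.trace]

theorem conj_diagonal_add_smul_one {V : Matrix n n ℂ} (hV : Vᴴ * V = 1) (r : n → ℝ) (c : ℝ) :
    V * Matrix.diagonal (fun i => (r i : ℂ)) * Vᴴ + (c : ℂ) • (1 : Matrix n n ℂ)
      = V * Matrix.diagonal (fun i => ((r i + c : ℝ) : ℂ)) * Vᴴ := by
  have h1 : Matrix.diagonal (fun i => ((r i + c : ℝ) : ℂ))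
      = Matrix.diagonal (fun i => (r i : ℂ)) + (c : ℂ) • (1 : Matrix n n ℂ) := by
    ext i j; by_cases h : i = j <;> simp [h]
  rw [h1, Matrix.mul_add, Matrix.add_mul, Matrix.mul_smul, Matrix.smul_mul, Matrix.mul_one,
    mul_eq_one_comm.1 hV]

theorem entropy_zero : entropy (0 : Matrix n n ℂ) = 0 := by simp [entropy]

/-- Regularised form of strong subadditivity: the relative entropy of `ρ` with respect to
`1 ⊗ (ρ_BC + ε)` decreases under the partial trace over `B`. -/
theorem strong_subadditivity_regularised [Nonempty β]
    {ρ : Matrix ((α × γ) × β) ((α × γ) × β) ℂ} (h : ρ.PosSemidef)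
    {V : Matrix (γ × β) (γ × β) ℂ} {r : γ × β → ℝ} (hV : Vᴴ * V = 1) (hr : ∀ i, 0 ≤ r i)
    (hBC : traceFirst ρ = V * Matrix.diagonal (fun i => (r i : ℂ)) * Vᴴ)
    {W : Matrix γ γ ℂ} {q : γ → ℝ} (hW : Wᴴ * W = 1) (hq : ∀ i, 0 ≤ q i)
    (hC : traceRight (traceFirst ρ) = W * Matrix.diagonal (fun i => (q i : ℂ)) * Wᴴ)
    {ε : ℝ} (hε : 0 < ε) :
    -(entropy (traceRight ρ) * Real.log 2) - ∑ i, q i * Real.log (q i + Fintype.card β * ε)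
      ≤ -(entropy ρ * Real.log 2) - ∑ i, r i * Real.log (r i + ε) := by
  obtain ⟨U, p, hU, hp, hρ, hpS⟩ := exists_spectral_decomposition h
  obtain ⟨U', p', hU', hp', hρ', hpS'⟩ := exists_spectral_decomposition (traceRight_posSemidef h)
  have hN : (0 : ℝ) < Fintype.card β := by exact_mod_cast Fintype.card_pos
  set σ := oneFirst α (traceFirst ρ + (ε : ℂ) • (1 : Matrix (γ × β) (γ × β) ℂ)) with hσdef
  have hσ : σ = oneFirst α V * Matrix.diagonal (fun i : (α × γ) × β =>
      ((r (i.1.2, i.2) + ε : ℝ) : ℂ)) * (oneFirst α V)ᴴ := by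
    rw [hσdef, hBC, conj_diagonal_add_smul_one hV, oneFirst_mul, oneFirst_mul,
      oneFirst_diagonal, oneFirst_conjTranspose]
  have hdiag : ∀ f : γ → ℂ, (1 : Matrix α α ℂ) ⊗ₖ Matrix.diagonal f
      = Matrix.diagonal (fun i : α × γ => f i.2) := by
    intro f
    ext ⟨a, c⟩ ⟨a', c'⟩
    by_cases ha : a = a' <;> simp [Matrix.diagonal_apply, ha]
  have hsplit : ∀ f : γ → ℂ, (1 : Matrix α α ℂ) ⊗ₖ (W * Matrix.diagonal f * Wᴴ)
      = ((1 : Matrix α α ℂ) ⊗ₖ W) * Matrix.diagonal (fun i : α × γ => f i.2)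
        * ((1 : Matrix α α ℂ) ⊗ₖ W)ᴴ := by
    intro f
    rw [← hdiag, Matrix.conjTranspose_kronecker, Matrix.conjTranspose_one,
      ← Matrix.mul_kronecker_mul, ← Matrix.mul_kronecker_mul, Matrix.one_mul, Matrix.one_mul]
  have hσ' : traceRight σ = ((1 : Matrix α α ℂ) ⊗ₖ W) * Matrix.diagonal (fun i : α × γ =>
      ((q i.2 + Fintype.card β * ε : ℝ) : ℂ)) * ((1 : Matrix α α ℂ) ⊗ₖ W)ᴴ := by
    have h1 : traceRight (traceFirst ρ + (ε : ℂ) • (1 : Matrix (γ × β) (γ × β) ℂ))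
        = traceRight (traceFirst ρ) + ((Fintype.card β * ε : ℝ) : ℂ) • (1 : Matrix γ γ ℂ) := by
      ext i j
      by_cases hij : i = j <;>
        simp [traceRight, Finset.sum_add_distrib, hij, Matrix.one_apply]
    rw [hσdef, traceRight_oneFirst, h1, hC, conj_diagonal_add_smul_one hW, hsplit]
  have hWW : ((1 : Matrix α α ℂ) ⊗ₖ W)ᴴ * ((1 : Matrix α α ℂ) ⊗ₖ W) = 1 := by
    rw [Matrix.conjTranspose_kronecker, ← Matrix.mul_kronecker_mul, hW, Matrix.conjTranspose_one,
      Matrix.one_mul, Matrix.one_kronecker_one]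
  have hVV : (oneFirst α V)ᴴ * oneFirst α V = 1 := by
    rw [← oneFirst_conjTranspose, ← oneFirst_mul, hV, oneFirst_one]
  have key := relativeEntropy_traceRight_le hU hVV hU' hWW hρ hσ hρ' hσ' hp
    (fun i => add_pos_of_nonneg_of_pos (hr _) hε) hp'
    (fun i => add_pos_of_nonneg_of_pos (hq _) (mul_pos hN hε))
  rw [hpS, hpS', ← hsplit (fun i => (Real.log (q i + Fintype.card β * ε) : ℂ)),
    trace_traceRight_mul_one_kronecker, ← oneFirst_conjTranspose,
    ← oneFirst_diagonal (fun i => (Real.log (r i + ε) : ℂ)), ← oneFirst_mul, ← oneFirst_mul,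
    trace_mul_oneFirst, hC, hBC, trace_mul_conj_diagonal hV, trace_mul_conj_diagonal hW] at key
  exact key

/-- **Strong subadditivity** of the von Neumann entropy:
`H(ABC) + H(C) ≤ H(AC) + H(BC)`. -/
theorem strong_subadditivity {ρ : Matrix ((α × γ) × β) ((α × γ) × β) ℂ} (h : ρ.PosSemidef) :
    entropy ρ + entropy (traceRight (traceFirst ρ))
      ≤ entropy (traceRight ρ) + entropy (traceFirst ρ) := by
  rcases isEmpty_or_nonempty β with hβ | hβ
  · have h1 : ρ = 0 := by ext i; exact hβ.elim i.2
    have h2 : traceFirst ρ = 0 := by ext i; exact hβ.elim i.2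
    have h3 : traceRight ρ = 0 := by ext i j; simp [traceRight]
    have h4 : traceRight (traceFirst ρ) = 0 := by ext i j; simp [traceRight]
    rw [h4, h3, h2, h1]
    simp [entropy_zero]
  obtain ⟨V, r, hV, hr, hBC, hrS⟩ := exists_spectral_decomposition (traceFirst_posSemidef h)
  obtain ⟨W, q, hW, hq, hC, hqS⟩ := exists_spectral_decomposition
    (traceRight_posSemidef (traceFirst_posSemidef h))
  have hlim : ∀ {x c : ℝ}, 0 ≤ x →
      Tendsto (fun ε : ℝ => x * Real.log (x + c * ε)) (𝓝[>] 0) (𝓝 (x * Real.log x)) := by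
    intro x c hx
    rcases hx.eq_or_lt with rfl | hx
    · simp
    · have h1 : Tendsto (fun ε : ℝ => x + c * ε) (𝓝[>] 0) (𝓝 (x + c * 0)) :=
        tendsto_const_nhds.add ((tendsto_nhdsWithin_of_tendsto_nhds tendsto_id).const_mul c)
      rw [mul_zero, add_zero] at h1
      exact (h1.log hx.ne').const_mul _
  have key := le_of_tendsto_of_tendsto
    ((tendsto_const_nhds (x := -(entropy (traceRight ρ) * Real.log 2))).sub
      (tendsto_finsetSum Finset.univ fun i _ => hlim (c := Fintype.card β) (hq i)))
    ((tendsto_const_nhds (x := -(entropy ρ * Real.log 2))).sub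
      (tendsto_finsetSum Finset.univ fun i _ => hlim (c := 1) (hr i)))
    (by
      filter_upwards [self_mem_nhdsWithin] with ε hε
      simpa only [one_mul] using strong_subadditivity_regularised h hV hr hBC hW hq hC hε)
  rw [hrS, hqS] at key
  have : 0 < Real.log 2 := Real.log_pos one_lt_two
  nlinarith

end StrongSubadditivity

/-! ### Submodularity of the entropies of the reduced states -/

section Submodularity

variable {S : Type*} [Fintype S] [DecidableEq S] {H : S → Type*} [∀ a, Fintype (H a)]
  [∀ a, DecidableEq (H a)] {E : Type*} [Fintype E] [DecidableEq E]

/-- Families over a disjoint union of two sets of parties are pairs of families. -/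
def mergeEquiv (H : S → Type*) {p q r : S → Prop} [DecidablePred p] (hr : ∀ a, r a ↔ p a ∨ q a)
    (hpq : ∀ a, p a → ¬ q a) :
    ((a : {a // p a}) → H a) × ((a : {a // q a}) → H a) ≃ ((a : {a // r a}) → H a) where
  toFun x a := if h : p a then x.1 ⟨a, h⟩ else x.2 ⟨a, ((hr a).1 a.2).resolve_left h⟩
  invFun y := (fun a => y ⟨a, (hr a).2 (Or.inl a.2)⟩, fun a => y ⟨a, (hr a).2 (Or.inr a.2)⟩)
  left_inv x := by
    ext a
    · simp [a.2]
    · have : ¬ p a := fun h => hpq a h a.2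
      simp [this]
  right_inv y := by
    ext a
    dsimp only
    split_ifs <;> rfl

theorem reduced_apply_of_equiv (ω : Matrix (((a : S) → H a) × E) (((a : S) → H a) × E) ℂ)
    (X : Finset S) {R : Type*} [Fintype R] (e : R ≃ ((a : {a // a ∉ X}) → H a))
    (p q : ((a : {a // a ∈ X}) → H a) × E) :
    reduced ω X p q = ∑ r, ω (glue X p.1 (e r), p.2) (glue X q.1 (e r), q.2) := by
  rw [reduced, Matrix.of_apply,
    ← e.sum_comp (fun z => ω (glue X p.1 z, p.2) (glue X q.1 z, q.2))]

theorem reduced_posSemidef {ω : Matrix (((a : S) → H a) × E) (((a : S) → H a) × E) ℂ}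
    (h : ω.PosSemidef) (X : Finset S) : (reduced ω X).PosSemidef := by
  have : reduced ω X = ∑ z, ω.submatrix (fun p => (glue X p.1 z, p.2))
      (fun p => (glue X p.1 z, p.2)) := by
    ext i j; simp [reduced, Matrix.sum_apply]
  rw [this]
  exact Matrix.posSemidef_sum _ fun k _ => h.submatrix _

/-- Strong subadditivity for the reductions of a state to sets of parties. -/
theorem entropy_reduced_submodular {ω : Matrix (((a : S) → H a) × E) (((a : S) → H a) × E) ℂ}
    (h : ω.PosSemidef) (A B : Finset S) :
    entropy (reduced ω (A ∪ B)) + entropy (reduced ω (A ∩ B))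
      ≤ entropy (reduced ω A) + entropy (reduced ω B) := by
  -- `A \ B`, `A ∩ B`, `B \ A` and the complement of `A ∪ B` are the four subsystems; the `e`s and
  -- `g`s assemble the systems that are kept, and the `f`s those that are traced out
  set eA : ((a : {a // a ∈ A \ B}) → H a) × ((a : {a // a ∈ A ∩ B}) → H a)
      ≃ ((a : {a // a ∈ A}) → H a) := mergeEquiv H (by intro a; simp; tauto)
        (by intro a; simp; tauto) with heA
  set eB : ((a : {a // a ∈ A ∩ B}) → H a) × ((a : {a // a ∈ B \ A}) → H a)
      ≃ ((a : {a // a ∈ B}) → H a) := mergeEquiv H (by intro a; simp; tauto)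
        (by intro a; simp; tauto) with heB
  set eU : ((a : {a // a ∈ A}) → H a) × ((a : {a // a ∈ B \ A}) → H a)
      ≃ ((a : {a // a ∈ A ∪ B}) → H a) := mergeEquiv H (by intro a; simp; tauto)
        (by intro a; simp; tauto) with heU
  set fA : ((a : {a // a ∈ B \ A}) → H a) × ((a : {a // a ∉ A ∪ B}) → H a)
      ≃ ((a : {a // a ∉ A}) → H a) := mergeEquiv H (by intro a; simp; tauto)
        (by intro a; simp; tauto) with hfA
  set fB : ((a : {a // a ∈ A \ B}) → H a) × ((a : {a // a ∉ A ∪ B}) → H a)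
      ≃ ((a : {a // a ∉ B}) → H a) := mergeEquiv H (by intro a; simp; tauto)
        (by intro a; simp; tauto) with hfB
  set fI : ((a : {a // a ∈ B \ A}) → H a) × ((a : {a // a ∉ B}) → H a)
      ≃ ((a : {a // a ∉ A ∩ B}) → H a) := mergeEquiv H (by intro a; simp; tauto)
        (by intro a; simp; tauto) with hfI
  set gU : (((a : {a // a ∈ A \ B}) → H a) × (((a : {a // a ∈ A ∩ B}) → H a) × E))
      × ((a : {a // a ∈ B \ A}) → H a) ≃ ((a : {a // a ∈ A ∪ B}) → H a) × E :=
    { toFun := fun p => (eU (eA (p.1.1, p.1.2.1), p.2), p.1.2.2)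
      invFun := fun q => (((eA.symm (eU.symm q.1).1).1, ((eA.symm (eU.symm q.1).1).2, q.2)),
        (eU.symm q.1).2)
      left_inv := fun p => by simp
      right_inv := fun q => by simp } with hgU
  set gA : ((a : {a // a ∈ A \ B}) → H a) × (((a : {a // a ∈ A ∩ B}) → H a) × E)
      ≃ ((a : {a // a ∈ A}) → H a) × E :=
    (Equiv.prodAssoc _ _ _).symm.trans (Equiv.prodCongr eA (Equiv.refl E)) with hgA
  set gB : (((a : {a // a ∈ A ∩ B}) → H a) × E) × ((a : {a // a ∈ B \ A}) → H a)
      ≃ ((a : {a // a ∈ B}) → H a) × E :=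
    { toFun := fun p => (eB (p.1.1, p.2), p.1.2)
      invFun := fun q => (((eB.symm q.1).1, q.2), (eB.symm q.1).2)
      left_inv := fun p => by simp
      right_inv := fun q => by simp } with hgB
  have hglue : ∀ x c y w, glue (A ∪ B) (eU (eA (x, c), y)) w = glue A (eA (x, c)) (fA (y, w)) := by
    intro x c y w
    ext a
    by_cases hA : a ∈ A <;> by_cases hB : a ∈ B <;>
      simp [glue, heA, heU, hfA, mergeEquiv, hA, hB]
  have hglueB : ∀ x c y w, glue (A ∪ B) (eU (eA (x, c), y)) w = glue B (eB (c, y)) (fB (x, w)) := by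
    intro x c y w
    ext a
    by_cases hA : a ∈ A <;> by_cases hB : a ∈ B <;>
      simp [glue, heA, heU, heB, hfB, mergeEquiv, hA, hB]
  have hglueI : ∀ x c y w, glue B (eB (c, y)) (fB (x, w))
      = glue (A ∩ B) c (fI (y, fB (x, w))) := by
    intro x c y w
    ext a
    by_cases hA : a ∈ A <;> by_cases hB : a ∈ B <;>
      simp [glue, heB, hfB, hfI, mergeEquiv, hA, hB]
  set τ := (reduced ω (A ∪ B)).submatrix gU gU with hτ
  have hτpos : τ.PosSemidef := (reduced_posSemidef h _).submatrix _
  have h1 : traceRight τ = (reduced ω A).submatrix gA gA := by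
    ext p q
    rw [Matrix.submatrix_apply, reduced_apply_of_equiv ω A fA, Fintype.sum_prod_type]
    simp [hτ, hgU, hgA, traceRight, reduced, hglue]
  have h2 : traceFirst τ = (reduced ω B).submatrix gB gB := by
    ext p q
    rw [Matrix.submatrix_apply, reduced_apply_of_equiv ω B fB, Fintype.sum_prod_type]
    simp [hτ, hgU, hgB, traceFirst, reduced, hglueB]
  have h3 : traceRight (traceFirst τ) = reduced ω (A ∩ B) := by
    ext p q
    rw [reduced_apply_of_equiv ω (A ∩ B) fI, Fintype.sum_prod_type, h2]
    simp only [traceRight, Matrix.of_apply, Matrix.submatrix_apply]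
    refine Finset.sum_congr rfl fun y _ => ?_
    rw [← fB.sum_comp, reduced_apply_of_equiv ω B fB]
    refine Finset.sum_congr rfl fun z _ => ?_
    simp [hgB, ← hglueI]
  have key := strong_subadditivity hτpos
  rwa [h3, h1, h2, hτ, entropy_submatrix_equiv (reduced_posSemidef h _).1,
    entropy_submatrix_equiv (reduced_posSemidef h _).1,
    entropy_submatrix_equiv (reduced_posSemidef h _).1] at key

/-- Telescoping submodularity over the unions of more and more blocks. -/
theorem sum_parts_ge_of_submodular {f : Finset S → ℝ}
    (hf : ∀ A B, f (A ∪ B) + f (A ∩ B) ≤ f A + f B) (P : Finset (Finset S))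
    (hP : (P : Set (Finset S)).PairwiseDisjoint id) :
    f (P.sup id) + P.card * f ∅ ≤ ∑ X ∈ P, f X + f ∅ := by
  induction P using Finset.induction_on with
  | empty => simp
  | insert X P hX ih =>
    have ih := ih (hP.subset (by simp))
    have hdisj : Disjoint X (P.sup id) := by
      rw [Finset.disjoint_sup_right]
      intro Y hY
      exact hP (by simp) (by simp [hY]) (by rintro rfl; exact hX hY)
    have h := hf X (P.sup id)
    rw [Finset.disjoint_iff_inter_eq_empty.1 hdisj] at h
    rw [Finset.sup_insert, Finset.sum_insert hX, Finset.card_insert_of_notMem hX, id,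
      Finset.sup_eq_union]
    push_cast
    linarith

/-- Telescoping submodularity over the complements of the unions of more and more blocks. -/
theorem sum_compl_parts_ge_of_submodular {f : Finset S → ℝ}
    (hf : ∀ A B, f (A ∪ B) + f (A ∩ B) ≤ f A + f B) (P : Finset (Finset S))
    (hP : (P : Set (Finset S)).PairwiseDisjoint id) :
    f (Finset.univ \ P.sup id) + P.card * f Finset.univ
      ≤ ∑ X ∈ P, f (Finset.univ \ X) + f Finset.univ := by
  induction P using Finset.induction_on with
  | empty => simp
  | insert X P hX ih =>
    have ih := ih (hP.subset (by simp))
    have hdisj : Disjoint X (P.sup id) := by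
      rw [Finset.disjoint_sup_right]
      intro Y hY
      exact hP (by simp) (by simp [hY]) (by rintro rfl; exact hX hY)
    have h := hf (Finset.univ \ X) (Finset.univ \ P.sup id)
    have h1 : (Finset.univ \ X) ∪ (Finset.univ \ P.sup id) = Finset.univ := by
      rw [← Finset.sdiff_inter_distrib_right, Finset.disjoint_iff_inter_eq_empty.1 hdisj,
        Finset.sdiff_empty]
    rw [h1, ← Finset.sdiff_union_distrib] at h
    rw [Finset.sup_insert, Finset.sum_insert hX, Finset.card_insert_of_notMem hX, id,
      Finset.sup_eq_union]
    push_cast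
    linarith

theorem condInfo_nonneg {ω : Matrix (((a : S) → H a) × E) (((a : S) → H a) × E) ℂ}
    (h : ω.PosSemidef) (G : Finpartition (Finset.univ : Finset S)) : 0 ≤ condInfo G ω := by
  have := sum_parts_ge_of_submodular (f := fun X => entropy (reduced ω X))
    (entropy_reduced_submodular h) G.parts G.disjoint
  rw [G.sup_parts] at this
  simp only [condInfo, condEntropy, Finset.sum_sub_distrib, Finset.sum_const, nsmul_eq_mul]
  linarith

theorem condInfoTilde_nonneg {ω : Matrix (((a : S) → H a) × E) (((a : S) → H a) × E) ℂ}
    (h : ω.PosSemidef) (G : Finpartition (Finset.univ : Finset S)) : 0 ≤ condInfoTilde G ω := by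
  have := sum_compl_parts_ge_of_submodular (f := fun X => entropy (reduced ω X))
    (entropy_reduced_submodular h) G.parts G.disjoint
  rw [G.sup_parts, Finset.sdiff_self] at this
  simp only [condInfoTilde, condEntropy, Finset.sum_sub_distrib, Finset.sum_const, nsmul_eq_mul]
  linarith

end Submodularity

/-! ### Operators acting on the systems of one tensor factor -/

section Slots

variable {S : Type*} [Fintype S] [DecidableEq S] {F : Finset S → S → Type*}
  [∀ K a, Fintype (F K a)] [∀ K a, DecidableEq (F K a)] {E : Type*} [Fintype E] [DecidableEq E]

/-- The basis index set of a party `a` that holds, for each set `K` of at least two parties with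
`a ∈ K`, a system with basis index set `F K a`. -/
abbrev FactorPartyIndex (F : Finset S → S → Type*) (a : S) : Type _ :=
  (K : {K : Finset S // a ∈ K ∧ 2 ≤ K.card}) → F K a

/-- The basis index set of the systems of the tensor factor shared by the parties in `M`. -/
abbrev SlotIndex (F : Finset S → S → Type*) (M : {K : Finset S // 2 ≤ K.card}) : Type _ :=
  (a : {a // a ∈ M.1}) → F M a

/-- The component of a basis index of the joint system on the tensor factor `M`. -/
def slot (M : {K : Finset S // 2 ≤ K.card}) (x : (a : S) → FactorPartyIndex F a) :
    SlotIndex F M :=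
  fun a => x a ⟨M, a.2, M.2⟩

/-- The systems, sorted by tensor factor instead of by party. -/
def slotEquiv (F : Finset S → S → Type*) :
    ((a : S) → FactorPartyIndex F a) ≃ ((M : {K : Finset S // 2 ≤ K.card}) → SlotIndex F M) where
  toFun x M := slot M x
  invFun u a K := u ⟨K, K.2.2⟩ ⟨a, K.2.1⟩
  left_inv _ := rfl
  right_inv _ := rfl

/-- The systems of the tensor factor `M`, separated from all other systems. -/
def slotSplit (F : Finset S → S → Type*) (E : Type*)
    (M : {K : Finset S // 2 ≤ K.card}) :
    ((a : S) → FactorPartyIndex F a) × E ≃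
      SlotIndex F M × (((K : {K // K ≠ M}) → SlotIndex F K.1) × E) :=
  (Equiv.prodCongr ((slotEquiv F).trans (Equiv.piSplitAt M _)) (Equiv.refl E)).trans
    (Equiv.prodAssoc _ _ _)

/-- The operator on the joint system with `E` that acts as `B` on the tensor factor `M` and
trivially elsewhere. -/
def slotOp (E : Type*) [DecidableEq E] (M : {K : Finset S // 2 ≤ K.card})
    (B : Matrix (SlotIndex F M) (SlotIndex F M) ℂ) :
    Matrix (((a : S) → FactorPartyIndex F a) × E) (((a : S) → FactorPartyIndex F a) × E) ℂ :=
  (B ⊗ₖ (1 : Matrix (((K : {K // K ≠ M}) → SlotIndex F K.1) × E) _ ℂ)).submatrix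
    (slotSplit F E M) (slotSplit F E M)

theorem slotOp_apply (M : {K : Finset S // 2 ≤ K.card})
    (B : Matrix (SlotIndex F M) (SlotIndex F M) ℂ)
    (p q : ((a : S) → FactorPartyIndex F a) × E) :
    slotOp E M B p q = if (∀ K, K ≠ M → slot K p.1 = slot K q.1) ∧ p.2 = q.2 then
      B (slot M p.1) (slot M q.1) else 0 := by
  simp only [slotOp, Matrix.submatrix_apply, Matrix.kroneckerMap_apply, Matrix.one_apply, mul_ite,
    mul_one, mul_zero]
  congr 1
  simp [slotSplit, slotEquiv, Equiv.piSplitAt, funext_iff, Prod.ext_iff]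
  exact fun _ => Iff.rfl

variable {M : {K : Finset S // 2 ≤ K.card}}

theorem slotOp_mul (A B : Matrix (SlotIndex F M) (SlotIndex F M) ℂ) :
    slotOp E M (A * B) = slotOp E M A * slotOp E M B := by
  rw [slotOp, slotOp, slotOp, Matrix.submatrix_mul_equiv, ← Matrix.mul_kronecker_mul,
    Matrix.one_mul]

theorem slotOp_conjTranspose (A : Matrix (SlotIndex F M) (SlotIndex F M) ℂ) :
    slotOp E M Aᴴ = (slotOp E M A)ᴴ := by
  rw [slotOp, slotOp, Matrix.conjTranspose_submatrix, Matrix.conjTranspose_kronecker,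
    Matrix.conjTranspose_one]

theorem slotOp_smul (c : ℝ) (A : Matrix (SlotIndex F M) (SlotIndex F M) ℂ) :
    slotOp E M (c • A) = c • slotOp E M A := by
  ext p q
  simp [slotOp, mul_assoc]

theorem slotOp_sum {ι : Type*} (t : Finset ι)
    (A : ι → Matrix (SlotIndex F M) (SlotIndex F M) ℂ) :
    slotOp E M (∑ i ∈ t, A i) = ∑ i ∈ t, slotOp E M (A i) := by
  ext p q
  simp [slotOp, Matrix.sum_apply, Finset.sum_mul]

-- decidable equality on the nested dependent products exceeds the default instance size
set_option synthInstance.maxSize 1000 in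
theorem slotOp_diagonal (f : SlotIndex F M → ℂ) :
    slotOp E M (Matrix.diagonal f) = Matrix.diagonal fun p => f (slot M p.1) := by
  rw [slotOp, ← Matrix.diagonal_one, Matrix.diagonal_kronecker_diagonal,
    Matrix.submatrix_diagonal_equiv]
  simp only [mul_one]
  rfl

theorem slotOp_mul_diagonal_comm {M' : {K : Finset S // 2 ≤ K.card}} (hM : M' ≠ M)
    (A : Matrix (SlotIndex F M') (SlotIndex F M') ℂ) (f : SlotIndex F M → ℂ) :
    slotOp E M' A * slotOp E M (Matrix.diagonal f)
      = slotOp E M (Matrix.diagonal f) * slotOp E M' A := by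
  ext p q
  rw [slotOp_diagonal, Matrix.mul_diagonal, Matrix.diagonal_mul, slotOp_apply]
  split_ifs with h
  · rw [h.1 M hM.symm, mul_comm]
  · simp

end Slots

section Locality

variable {S : Type*} [Fintype S] [DecidableEq S] {H : S → Type*} [∀ a, Fintype (H a)]
  [∀ a, DecidableEq (H a)] {E : Type*} [Fintype E] [DecidableEq E]

/-- The joint system, split into the parties in `X` together with `E`, and the other parties. -/
def glueEquiv (H : S → Type*) (E : Type*) (X : Finset S) :
    (((a : {a // a ∈ X}) → H a) × E) × ((a : {a // a ∉ X}) → H a) ≃ ((a : S) → H a) × E where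
  toFun p := (glue X p.1.1 p.2, p.1.2)
  invFun q := ((fun a => q.1 a, q.2), fun a => q.1 a)
  left_inv p := by
    ext a
    · simp [glue, a.2]
    · rfl
    · simp [glue, a.2]
  right_inv q := by
    ext a
    · simp [glue]
    · rfl

theorem reduced_eq_traceRight (ω : Matrix (((a : S) → H a) × E) (((a : S) → H a) × E) ℂ)
    (X : Finset S) :
    reduced ω X = traceRight (ω.submatrix (glueEquiv H E X) (glueEquiv H E X)) := rfl

theorem trace_reduced (ω : Matrix (((a : S) → H a) × E) (((a : S) → H a) × E) ℂ)
    (X : Finset S) : (reduced ω X).trace = ω.trace := by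
  rw [reduced_eq_traceRight, trace_traceRight]
  simp only [Matrix.trace, Matrix.diag_apply, Matrix.submatrix_apply]
  exact (glueEquiv H E X).sum_comp (fun p => ω p p)

variable {F : Finset S → S → Type*}
  [∀ K a, Fintype (F K a)] [∀ K a, DecidableEq (F K a)] {M : {K : Finset S // 2 ≤ K.card}}
  {Y : Finset S}

/-- If all parties in `M` belong to `Y`, an operator on the tensor factor `M` is an operator on the
systems of `Y`. -/
theorem exists_slotOp_eq_kronecker_one (hM : M.1 ⊆ Y)
    (B : Matrix (SlotIndex F M) (SlotIndex F M) ℂ) :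
    ∃ B', (slotOp E M B).submatrix (glueEquiv _ E Y) (glueEquiv _ E Y) = B' ⊗ₖ 1 := by
  classical
  refine ⟨Matrix.of fun p q => if (∀ a K, K.1 ≠ M.1 → p.1 a K = q.1 a K) ∧ p.2 = q.2 then
    B (fun a => p.1 ⟨a, hM a.2⟩ ⟨M, a.2, M.2⟩) (fun a => q.1 ⟨a, hM a.2⟩ ⟨M, a.2, M.2⟩) else 0, ?_⟩
  ext ⟨⟨x, e⟩, z⟩ ⟨⟨y, f⟩, w⟩
  simp only [Matrix.submatrix_apply, slotOp_apply, Matrix.kroneckerMap_apply, Matrix.one_apply,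
    Matrix.of_apply, mul_ite, mul_one, mul_zero]
  have hslot : ∀ (x : (a : {a // a ∈ Y}) → FactorPartyIndex F a) (z), slot M (glue Y x z)
      = fun a : {a // a ∈ M.1} => x ⟨a, hM a.2⟩ ⟨M, a.2, M.2⟩ := by
    intro x z
    funext a
    simp [slot, glue, hM a.2]
  by_cases hz : z = w
  · subst hz
    simp only [glueEquiv, Equiv.coe_fn_mk, hslot, if_true]
    congr 1
    rw [eq_iff_iff]
    refine and_congr_left fun _ => ⟨fun h a K hK => ?_, fun h K hK => ?_⟩
    · have := congrFun (h ⟨K, K.2.2⟩ (fun h => hK (congrArg Subtype.val h))) ⟨a, K.2.1⟩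
      simpa [slot, glue] using this
    · funext a
      by_cases ha : a.1 ∈ Y
      · simpa [slot, glue, ha] using h ⟨a, ha⟩ ⟨K, a.2, K.2⟩ (fun h => hK (Subtype.ext h))
      · simp [slot, glue, ha]
  · rw [if_neg hz, if_neg]
    rintro ⟨h, -⟩
    refine hz ?_
    funext a K
    have hK : (⟨K.1, K.2.2⟩ : {K : Finset S // 2 ≤ K.card}) ≠ M := by
      rintro rfl
      exact a.2 (hM K.2.1)
    have := congrFun (h ⟨K, K.2.2⟩ hK) ⟨a, K.2.1⟩
    simpa [slot, glue, glueEquiv, a.2] using this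

/-- If no party in `M` belongs to `Y`, an operator on the tensor factor `M` is an operator on the
systems that are traced out in the reduction to `Y`. -/
theorem exists_slotOp_eq_one_kronecker (hM : Disjoint M.1 Y)
    (B : Matrix (SlotIndex F M) (SlotIndex F M) ℂ) :
    ∃ B', (slotOp E M B).submatrix (glueEquiv _ E Y) (glueEquiv _ E Y) = 1 ⊗ₖ B' := by
  classical
  have hM' : ∀ {a}, a ∈ M.1 → a ∉ Y := fun ha => Finset.disjoint_left.1 hM ha
  refine ⟨Matrix.of fun p q => if (∀ a K, K.1 ≠ M.1 → p a K = q a K) then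
    B (fun a => p ⟨a, hM' a.2⟩ ⟨M, a.2, M.2⟩) (fun a => q ⟨a, hM' a.2⟩ ⟨M, a.2, M.2⟩) else 0, ?_⟩
  ext ⟨⟨x, e⟩, z⟩ ⟨⟨y, f⟩, w⟩
  simp only [Matrix.submatrix_apply, slotOp_apply, Matrix.kroneckerMap_apply, Matrix.one_apply,
    Matrix.of_apply, ite_mul, one_mul, zero_mul]
  have hslot : ∀ (x : (a : {a // a ∈ Y}) → FactorPartyIndex F a) (z), slot M (glue Y x z)
      = fun a : {a // a ∈ M.1} => z ⟨a, hM' a.2⟩ ⟨M, a.2, M.2⟩ := by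
    intro x z
    funext a
    simp [slot, glue, hM' a.2]
  by_cases hx : (x, e) = (y, f)
  · obtain ⟨rfl, rfl⟩ := Prod.ext_iff.1 hx
    simp only [glueEquiv, Equiv.coe_fn_mk, hslot, if_true, and_true]
    congr 1
    rw [eq_iff_iff]
    refine ⟨fun h a K hK => ?_, fun h K hK => ?_⟩
    · have := congrFun (h ⟨K, K.2.2⟩ (fun h => hK (congrArg Subtype.val h))) ⟨a, K.2.1⟩
      simpa [slot, glue, a.2] using this
    · funext a
      by_cases ha : a.1 ∈ Y
      · simp [slot, glue, ha]
      · simpa [slot, glue, ha] using h ⟨a, ha⟩ ⟨K, a.2, K.2⟩ (fun h => hK (Subtype.ext h))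
  · rw [if_neg hx, if_neg]
    rintro ⟨h, he⟩
    refine hx (Prod.ext ?_ he)
    funext a K
    have hK : (⟨K.1, K.2.2⟩ : {K : Finset S // 2 ≤ K.card}) ≠ M := by
      rintro rfl
      exact hM' K.2.1 a.2
    have := congrFun (h ⟨K, K.2.2⟩ hK) ⟨a, K.2.1⟩
    simpa [slot, glue, glueEquiv, a.2] using this

theorem reduced_slotOp_mul_comm (hM : Disjoint M.1 Y)
    (B : Matrix (SlotIndex F M) (SlotIndex F M) ℂ)
    (ω : Matrix (((a : S) → FactorPartyIndex F a) × E) (((a : S) → FactorPartyIndex F a) × E) ℂ) :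
    reduced (slotOp E M B * ω) Y = reduced (ω * slotOp E M B) Y := by
  obtain ⟨B', hB'⟩ := exists_slotOp_eq_one_kronecker (E := E) hM B
  rw [reduced_eq_traceRight, reduced_eq_traceRight,
    ← Matrix.submatrix_mul_equiv _ _ _ (glueEquiv _ E Y),
    ← Matrix.submatrix_mul_equiv _ _ _ (glueEquiv _ E Y), hB', traceRight_one_kronecker_mul_comm]

/-- Conjugation by an operator of the tensor factor `M` that is isometric on the support of `ω` does
not change the entropy of the reduction to a set of parties that contains `M`. -/
theorem entropy_reduced_conj_isometry (hM : M.1 ⊆ Y)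
    {ω : Matrix (((a : S) → FactorPartyIndex F a) × E) (((a : S) → FactorPartyIndex F a) × E) ℂ}
    (hω : ω.PosSemidef) {L : Matrix (SlotIndex F M) (SlotIndex F M) ℂ}
    (hL : slotOp E M (Lᴴ * L) * ω = ω) :
    entropy (reduced (slotOp E M L * ω * (slotOp E M L)ᴴ) Y) = entropy (reduced ω Y) := by
  obtain ⟨L', hL'⟩ := exists_slotOp_eq_kronecker_one (E := E) hM L
  have hLs : ((slotOp E M L)ᴴ).submatrix (glueEquiv _ E Y) (glueEquiv _ E Y) = L'ᴴ ⊗ₖ 1 := by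
    rw [← Matrix.conjTranspose_submatrix, hL', Matrix.conjTranspose_kronecker,
      Matrix.conjTranspose_one]
  have h1 : reduced (slotOp E M L * ω * (slotOp E M L)ᴴ) Y = L' * reduced ω Y * L'ᴴ := by
    rw [reduced_eq_traceRight, ← Matrix.submatrix_mul_equiv _ _ _ (glueEquiv _ E Y), hLs,
      traceRight_mul_kronecker_one, ← Matrix.submatrix_mul_equiv _ _ _ (glueEquiv _ E Y), hL',
      traceRight_kronecker_one_mul]
    rfl
  have h2 : L'ᴴ * L' * reduced ω Y = reduced ω Y := by
    conv_rhs => rw [← hL, slotOp_mul, slotOp_conjTranspose]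
    rw [reduced_eq_traceRight (_ * _), ← Matrix.submatrix_mul_equiv _ _ _ (glueEquiv _ E Y),
      ← Matrix.submatrix_mul_equiv _ _ _ (glueEquiv _ E Y), hLs, hL', ← Matrix.mul_kronecker_mul,
      Matrix.one_mul, traceRight_kronecker_one_mul]
    rfl
  rw [h1, entropy_conj_isometry (reduced_posSemidef hω _).1 h2]

end Locality

/-! ### Measuring a shared key -/

section Key

variable {S : Type*} [Fintype S] [DecidableEq S] {F : Finset S → S → Type*}
  [∀ K a, Fintype (F K a)] [∀ K a, DecidableEq (F K a)] {E : Type*} [Fintype E] [DecidableEq E]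
  {M : {K : Finset S // 2 ≤ K.card}} {ι : Type*} [Fintype ι] [DecidableEq ι]
  {key : (a : {a // a ∈ M.1}) → F M a → ι}

theorem reduced_smul {H : S → Type*} [∀ a, Fintype (H a)] (c : ℝ)
    (A : Matrix (((a : S) → H a) × E) (((a : S) → H a) × E) ℂ) (Y : Finset S) :
    reduced (c • A) Y = c • reduced A Y := by
  ext x y
  simp [reduced, Finset.mul_sum]

theorem reduced_sum {H : S → Type*} [∀ a, Fintype (H a)] {κ : Type*} (t : Finset κ)
    (A : κ → Matrix (((a : S) → H a) × E) (((a : S) → H a) × E) ℂ) (Y : Finset S) :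
    reduced (∑ i ∈ t, A i) Y = ∑ i ∈ t, reduced (A i) Y := by
  ext x y
  simp only [reduced, Matrix.of_apply, Matrix.sum_apply]
  rw [Finset.sum_comm]

/-- The projection onto the event that every party in `M` holds the key value `i`. -/
def keyProj (key : (a : {a // a ∈ M.1}) → F M a → ι) (i : ι) :
    Matrix (SlotIndex F M) (SlotIndex F M) ℂ :=
  Matrix.diagonal fun u => if ∀ a, key a (u a) = i then 1 else 0

/-- `q` behaves like the projection onto the twisted GHZ states `|ι|^{-1/2} ∑ᵢ |i…i⟩ ⊗ Uⁱ|φ⟩` of a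
perfect key: on its range the key values of the parties agree, and each value `i` is
found with probability `1/|ι|` whatever `φ` is. -/
structure IsKeyProjection (key : (a : {a // a ∈ M.1}) → F M a → ι)
    (q : Matrix (SlotIndex F M) (SlotIndex F M) ℂ) : Prop where
  conjTranspose_eq : qᴴ = q
  sum_mul : (∑ i, keyProj key i) * q = q
  mul_keyProj_mul : ∀ i, q * keyProj key i * q = (Fintype.card ι : ℝ)⁻¹ • q

/-- The state after the key value `i` has been found, under the assumption that all key values are
equally likely. -/
def measured (key : (a : {a // a ∈ M.1}) → F M a → ι) (i : ι)
    (ω : Matrix (((a : S) → FactorPartyIndex F a) × E) (((a : S) → FactorPartyIndex F a) × E) ℂ) :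
    Matrix (((a : S) → FactorPartyIndex F a) × E) (((a : S) → FactorPartyIndex F a) × E) ℂ :=
  (Fintype.card ι : ℝ) • (slotOp E M (keyProj key i) * ω * slotOp E M (keyProj key i))

theorem keyProj_conjTranspose (i : ι) : (keyProj key i)ᴴ = keyProj key i := by
  rw [keyProj, Matrix.diagonal_conjTranspose]
  congr 1
  ext u
  simp only [Pi.star_apply]
  split_ifs <;> simp

theorem keyProj_mul_self (i : ι) : keyProj key i * keyProj key i = keyProj key i := by
  rw [keyProj, Matrix.diagonal_mul_diagonal]
  congr 1
  ext u
  split_ifs <;> simp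

theorem slotOp_keyProj_mul_mul_apply (i j : ι)
    (ω : Matrix (((a : S) → FactorPartyIndex F a) × E) (((a : S) → FactorPartyIndex F a) × E) ℂ)
    (p r : ((a : S) → FactorPartyIndex F a) × E) :
    (slotOp E M (keyProj key i) * ω * slotOp E M (keyProj key j)) p r
      = if (∀ a, key a (slot M p.1 a) = i) ∧ (∀ a, key a (slot M r.1 a) = j) then ω p r else 0 := by
  rw [keyProj, keyProj, slotOp_diagonal, slotOp_diagonal, Matrix.mul_diagonal, Matrix.diagonal_mul]
  split_ifs <;> simp_all

variable {q : Matrix (SlotIndex F M) (SlotIndex F M) ℂ}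
  {ω : Matrix (((a : S) → FactorPartyIndex F a) × E) (((a : S) → FactorPartyIndex F a) × E) ℂ}

theorem mul_slotOp_eq_self (hq : qᴴ = q) (hω : ω.IsHermitian) (h : slotOp E M q * ω = ω) :
    ω * slotOp E M q = ω := by
  have := congrArg Matrix.conjTranspose h
  rwa [Matrix.conjTranspose_mul, ← slotOp_conjTranspose, hq, hω.eq] at this

theorem measured_posSemidef (hω : ω.PosSemidef) (i : ι) : (measured key i ω).PosSemidef := by
  have h := hω.mul_mul_conjTranspose_same (slotOp E M (keyProj key i))
  rw [← slotOp_conjTranspose, keyProj_conjTranspose] at h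
  exact h.smul (Nat.cast_nonneg _)

theorem IsKeyProjection.mul_keyProj_mul_slotOp [Nonempty ι] (hq : IsKeyProjection key q)
    (hω : ω.PosSemidef) (h : slotOp E M q * ω = ω) (i : ι) :
    (Fintype.card ι : ℝ) • (ω * slotOp E M (keyProj key i) * slotOp E M q) = ω := by
  have hN : (Fintype.card ι : ℝ) ≠ 0 := by exact_mod_cast Fintype.card_ne_zero
  have hr := mul_slotOp_eq_self hq.conjTranspose_eq hω.1 h
  conv_lhs => rw [← hr]
  rw [Matrix.mul_assoc, Matrix.mul_assoc, ← slotOp_mul, ← slotOp_mul, ← Matrix.mul_assoc,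
    hq.mul_keyProj_mul, slotOp_smul, Matrix.mul_smul, smul_smul, mul_inv_cancel₀ hN, one_smul, hr]

theorem IsKeyProjection.trace_measured [Nonempty ι] (hq : IsKeyProjection key q)
    (hω : ω.PosSemidef) (h : slotOp E M q * ω = ω) (i : ι) :
    (measured key i ω).trace = ω.trace := by
  conv_rhs => rw [← hq.mul_keyProj_mul_slotOp hω h i]
  rw [measured, Matrix.trace_smul, Matrix.trace_smul]
  congr 1
  rw [Matrix.trace_mul_comm, ← Matrix.mul_assoc, ← slotOp_mul, keyProj_mul_self,
    Matrix.trace_mul_comm _ (slotOp E M q), ← Matrix.mul_assoc, h, Matrix.trace_mul_comm]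

/-- Measuring the key of one tensor factor does not disturb the others. -/
theorem slotOp_mul_measured {M' : {K : Finset S // 2 ≤ K.card}} (hM : M' ≠ M)
    {q' : Matrix (SlotIndex F M') (SlotIndex F M') ℂ} (h : slotOp E M' q' * ω = ω) (i : ι) :
    slotOp E M' q' * measured key i ω = measured key i ω := by
  rw [measured, Matrix.mul_smul, ← Matrix.mul_assoc, ← Matrix.mul_assoc, keyProj,
    slotOp_mul_diagonal_comm hM, Matrix.mul_assoc _ _ ω, h]

/-- The key value is unknown to parties outside `M` and to `E`. -/
theorem IsKeyProjection.reduced_measured_of_disjoint [Nonempty ι] (hq : IsKeyProjection key q)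
    (hω : ω.PosSemidef) (h : slotOp E M q * ω = ω) (i : ι) {Y : Finset S}
    (hY : Disjoint M.1 Y) : reduced (measured key i ω) Y = reduced ω Y := by
  conv_rhs => rw [← hq.mul_keyProj_mul_slotOp hω h i]
  rw [measured, reduced_smul, reduced_smul, Matrix.mul_assoc, reduced_slotOp_mul_comm hY,
    Matrix.mul_assoc, ← slotOp_mul, keyProj_mul_self, ← reduced_slotOp_mul_comm hY q, ← Matrix.mul_assoc, h]

/-- If all parties in `M` are kept, the measured state is an isometric image of the original. -/
theorem IsKeyProjection.entropy_reduced_measured_of_subset [Nonempty ι]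
    (hq : IsKeyProjection key q) (hω : ω.PosSemidef) (h : slotOp E M q * ω = ω) (i : ι)
    {Y : Finset S} (hY : M.1 ⊆ Y) :
    entropy (reduced (measured key i ω) Y) = entropy (reduced ω Y) := by
  have hN : (0 : ℝ) < Fintype.card ι := by exact_mod_cast Fintype.card_pos
  have hr := mul_slotOp_eq_self hq.conjTranspose_eq hω.1 h
  set L := Real.sqrt (Fintype.card ι) • (keyProj key i * q) with hL
  have hLs : Lᴴ = Real.sqrt (Fintype.card ι) • (q * keyProj key i) := by
    rw [hL, Matrix.conjTranspose_smul, Matrix.conjTranspose_mul, hq.conjTranspose_eq,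
      keyProj_conjTranspose, star_trivial]
  have hLL : Lᴴ * L = q := by
    rw [hLs, hL, smul_mul_smul_comm, Real.mul_self_sqrt hN.le, Matrix.mul_assoc,
      ← Matrix.mul_assoc (keyProj key i), keyProj_mul_self, ← Matrix.mul_assoc,
      hq.mul_keyProj_mul, smul_smul, mul_inv_cancel₀ hN.ne', one_smul]
  rw [← entropy_reduced_conj_isometry hY hω (L := L) (by rw [hLL, h]), ← slotOp_conjTranspose, hLs,
    hL, slotOp_smul, slotOp_smul, slotOp_mul, slotOp_mul, Matrix.smul_mul, Matrix.smul_mul,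
    Matrix.mul_smul, smul_smul, Real.mul_self_sqrt hN.le, Matrix.mul_assoc _ _ ω, h,
    ← Matrix.mul_assoc _ _ (slotOp E M (keyProj key i)), Matrix.mul_assoc _ ω, hr, measured]

/-- If some but not all parties in `M` are kept, tracing out the others measures the key, and the
kept parties can read off the outcome. -/
theorem IsKeyProjection.entropy_reduced_of_split [Nonempty ι] (hq : IsKeyProjection key q)
    (hω : ω.PosSemidef) (htr : ω.trace = 1) (h : slotOp E M q * ω = ω) {Y : Finset S}
    {a b : S} (haM : a ∈ M.1) (haY : a ∈ Y) (hbM : b ∈ M.1) (hbY : b ∉ Y) :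
    entropy (reduced ω Y) = Real.logb 2 (Fintype.card ι)
      + (Fintype.card ι : ℝ)⁻¹ * ∑ i, entropy (reduced (measured key i ω) Y) := by
  have hN : (Fintype.card ι : ℝ) ≠ 0 := by exact_mod_cast Fintype.card_ne_zero
  have hr := mul_slotOp_eq_self hq.conjTranspose_eq hω.1 h
  have hl : (∑ i, slotOp E M (keyProj key i)) * ω = ω := by
    conv_lhs => rw [← h]
    rw [← slotOp_sum, ← Matrix.mul_assoc, ← slotOp_mul, hq.sum_mul, h]
  have hl' : ω * (∑ i, slotOp E M (keyProj key i)) = ω := by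
    have := congrArg Matrix.conjTranspose hl
    rw [Matrix.conjTranspose_mul, Matrix.conjTranspose_sum, hω.1.eq] at this
    simpa only [← slotOp_conjTranspose, keyProj_conjTranspose] using this
  have hkey : ∀ (x : (a : {a // a ∈ Y}) → FactorPartyIndex F a) (z), ∀ (c : {a // a ∈ M.1})
      (hc : c.1 ∈ Y), slot M (glue Y x z) c = x ⟨c, hc⟩ ⟨M, c.2, M.2⟩ := by
    intro x z c hc
    simp [slot, glue, hc]
  have hcross : ∀ i j, i ≠ j →
      reduced (slotOp E M (keyProj key i) * ω * slotOp E M (keyProj key j)) Y = 0 := by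
    -- the key value of the party `b`, which is traced out, would have to be both `i` and `j`
    intro i j hij
    ext p r
    rw [reduced, Matrix.of_apply]
    refine Finset.sum_eq_zero fun z _ => ?_
    rw [slotOp_keyProj_mul_mul_apply, if_neg]
    rintro ⟨h1, h2⟩
    refine hij ((h1 ⟨b, hbM⟩).symm.trans (Eq.trans ?_ (h2 ⟨b, hbM⟩)))
    simp [slot, glue, hbY]
  have hdecomp : reduced ω Y
      = ∑ i, (Fintype.card ι : ℝ)⁻¹ • reduced (measured key i ω) Y := by
    have hsum : reduced ω Y = ∑ i, ∑ j,
        reduced (slotOp E M (keyProj key i) * ω * slotOp E M (keyProj key j)) Y := by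
      conv_lhs => rw [← hl', ← hl]
      simp only [Finset.sum_mul, Finset.mul_sum, reduced_sum]
      rw [Finset.sum_comm]
    rw [hsum]
    refine Finset.sum_congr rfl fun i _ => ?_
    rw [Finset.sum_eq_single i (fun j _ hj => hcross i j hj.symm) (by simp)]
    rw [measured, reduced_smul, smul_smul, inv_mul_cancel₀ hN, one_smul]
  rw [hdecomp, entropy_uniform_mixture]
  · exact fun i => (reduced_posSemidef (measured_posSemidef hω i) Y).1
  · intro i
    rw [trace_reduced, hq.trace_measured hω h, htr]
  · intro i j hij
    ext p r
    rw [Matrix.mul_apply]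
    refine Finset.sum_eq_zero fun t _ => ?_
    -- a nonzero term would force the key value of the party `a` in `t` to be both `i` and `j`
    by_cases hi : key ⟨a, haM⟩ (t.1 ⟨a, haY⟩ ⟨M, haM, M.2⟩) = i
    · have h0 : reduced (measured key j ω) Y t r = 0 := by
        rw [reduced, Matrix.of_apply]
        refine Finset.sum_eq_zero fun z _ => ?_
        rw [measured, Matrix.smul_apply, slotOp_keyProj_mul_mul_apply, if_neg, smul_zero]
        rintro ⟨h1, -⟩
        have := h1 ⟨a, haM⟩
        rw [hkey _ _ _ haY] at this
        exact hij (hi.symm.trans this)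
      rw [h0, mul_zero]
    · have h0 : reduced (measured key i ω) Y p t = 0 := by
        rw [reduced, Matrix.of_apply]
        refine Finset.sum_eq_zero fun z _ => ?_
        rw [measured, Matrix.smul_apply, slotOp_keyProj_mul_mul_apply, if_neg, smul_zero]
        rintro ⟨-, h1⟩
        have := h1 ⟨a, haM⟩
        rw [hkey _ _ _ haY] at this
        exact hi this
      rw [h0, zero_mul]

/-- Measuring the key of the tensor factor `M` lowers the entropy of the reduction to `Y`, on
average, by `log |ι|` if `M` is split by `Y` and by nothing otherwise. -/
theorem IsKeyProjection.entropy_reduced [Nonempty ι] (hq : IsKeyProjection key q)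
    (hω : ω.PosSemidef) (htr : ω.trace = 1) (h : slotOp E M q * ω = ω) (Y : Finset S) :
    entropy (reduced ω Y)
      = (if ¬ Disjoint M.1 Y ∧ ¬ M.1 ⊆ Y then Real.logb 2 (Fintype.card ι) else 0)
        + (Fintype.card ι : ℝ)⁻¹ * ∑ i, entropy (reduced (measured key i ω) Y) := by
  have hN : (Fintype.card ι : ℝ) ≠ 0 := by exact_mod_cast Fintype.card_ne_zero
  split_ifs with hY
  · obtain ⟨a, haM, haY⟩ := Finset.not_disjoint_iff.1 hY.1
    obtain ⟨b, hbM, hbY⟩ := Finset.not_subset.1 hY.2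
    exact hq.entropy_reduced_of_split hω htr h haM haY hbM hbY
  · have : ∀ i, entropy (reduced (measured key i ω) Y) = entropy (reduced ω Y) := by
      intro i
      by_cases hd : Disjoint M.1 Y
      · rw [hq.reduced_measured_of_disjoint hω h i hd]
      · exact hq.entropy_reduced_measured_of_subset hω h i (by tauto)
    simp only [this, Finset.sum_const, Finset.card_univ, nsmul_eq_mul]
    field_simp
    ring

end Key

/-! ### The information bounds -/

section Bounds

variable {S : Type*} [Fintype S] [DecidableEq S]

theorem card_traceBlocks (M : Finset S) (G : Finpartition (Finset.univ : Finset S)) :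
    (traceBlocks M G).card = (G.parts.filter fun X => ¬ Disjoint M X).card := by
  have : traceBlocks M G = (G.parts.filter fun X => ¬ Disjoint M X).image fun X => X ∩ M := by
    ext Z
    simp only [traceBlocks, Finset.mem_erase, Finset.mem_image, Finset.mem_filter]
    constructor
    · rintro ⟨hZ, X, hX, rfl⟩
      refine ⟨X, ⟨hX, fun h => hZ ?_⟩, rfl⟩
      exact Finset.disjoint_iff_inter_eq_empty.1 h.symm
    · rintro ⟨X, ⟨hX, hd⟩, rfl⟩
      exact ⟨fun h => hd (Finset.disjoint_iff_inter_eq_empty.2 h).symm, X, hX, rfl⟩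
  rw [this, Finset.card_image_of_injOn]
  intro X hX Y hY hXY
  simp only [Finset.coe_filter, Set.mem_ofPred_eq] at hX hY
  obtain ⟨a, haM, haX⟩ := Finset.not_disjoint_iff.1 hX.2
  have haY : a ∈ Y := by
    have : a ∈ X ∩ M := Finset.mem_inter.2 ⟨haX, haM⟩
    rw [show X ∩ M = Y ∩ M from hXY] at this
    exact (Finset.mem_inter.1 this).1
  exact G.disjoint.elim hX.1 hY.1 (Finset.not_disjoint_iff.2 ⟨a, haX, haY⟩)

/-- A block splits a crossing set `M` if and only if it meets `M`. -/
theorem sum_parts_split {M : Finset S} {G : Finpartition (Finset.univ : Finset S)}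
    (hM : M ∈ crossing G) (c : ℝ) :
    ∑ X ∈ G.parts, (if ¬ Disjoint M X ∧ ¬ M ⊆ X then c else 0) = (traceBlocks M G).card * c := by
  rw [card_traceBlocks, ← nsmul_eq_mul, ← Finset.sum_const, Finset.sum_filter]
  refine Finset.sum_congr rfl fun X hX => ?_
  have := (Finset.mem_filter.1 hM).2.2 X hX
  simp [this]

/-- The complement of a block splits `M` if and only if the block does. -/
theorem sum_parts_split_compl {M : Finset S} {G : Finpartition (Finset.univ : Finset S)}
    (hM : M ∈ crossing G) (c : ℝ) :
    ∑ X ∈ G.parts, (if ¬ Disjoint M (Finset.univ \ X) ∧ ¬ M ⊆ Finset.univ \ X then c else 0)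
      = (traceBlocks M G).card * c := by
  rw [← sum_parts_split hM]
  refine Finset.sum_congr rfl fun X _ => ?_
  have h1 : Disjoint M (Finset.univ \ X) ↔ M ⊆ X := by
    rw [← Finset.compl_eq_univ_sdiff, disjoint_compl_right_iff]
  have h2 : M ⊆ Finset.univ \ X ↔ Disjoint M X := by
    rw [← Finset.compl_eq_univ_sdiff, Finset.subset_compl_iff_disjoint_right]
  simp only [h1, h2, and_comm]

variable {F : Finset S → S → Type*} [∀ K a, Fintype (F K a)] [∀ K a, DecidableEq (F K a)]
  {E : Type*} [Fintype E] [DecidableEq E]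
  {M : {K : Finset S // 2 ≤ K.card}} {ι : Type*} [Fintype ι] [DecidableEq ι] [Nonempty ι]
  {key : (a : {a // a ∈ M.1}) → F M a → ι} {q : Matrix (SlotIndex F M) (SlotIndex F M) ℂ}
  {ω : Matrix (((a : S) → FactorPartyIndex F a) × E) (((a : S) → FactorPartyIndex F a) × E) ℂ}
  {G : Finpartition (Finset.univ : Finset S)}

/-- Since `∅` does not split `M`, the entropy of `E` alone contributes no key term. -/
theorem IsKeyProjection.condEntropy_eq (hq : IsKeyProjection key q)
    (hω : ω.PosSemidef) (htr : ω.trace = 1) (h : slotOp E M q * ω = ω) (Y : Finset S) :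
    condEntropy ω Y
      = (if ¬ Disjoint M.1 Y ∧ ¬ M.1 ⊆ Y then Real.logb 2 (Fintype.card ι) else 0)
        + (Fintype.card ι : ℝ)⁻¹ * ∑ i, condEntropy (measured key i ω) Y := by
  simp only [condEntropy]
  rw [hq.entropy_reduced hω htr h Y, hq.entropy_reduced hω htr h ∅, Finset.sum_sub_distrib]
  simp
  ring

theorem IsKeyProjection.condInfo_eq (hq : IsKeyProjection key q)
    (hω : ω.PosSemidef) (htr : ω.trace = 1) (h : slotOp E M q * ω = ω) (hM : M.1 ∈ crossing G) :
    condInfo G ω = (traceBlocks M.1 G).card * Real.logb 2 (Fintype.card ι)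
      + (Fintype.card ι : ℝ)⁻¹ * ∑ i, condInfo G (measured key i ω) := by
  simp only [condInfo]
  simp_rw [hq.condEntropy_eq hω htr h, Finset.sum_add_distrib, sum_parts_split hM,
    ← Finset.mul_sum, Finset.sum_sub_distrib]
  rw [Finset.sum_comm]
  simp
  ring

theorem IsKeyProjection.condInfoTilde_eq (hq : IsKeyProjection key q)
    (hω : ω.PosSemidef) (htr : ω.trace = 1) (h : slotOp E M q * ω = ω) (hM : M.1 ∈ crossing G) :
    condInfoTilde G ω = (traceBlocks M.1 G).card * Real.logb 2 (Fintype.card ι)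
      + (Fintype.card ι : ℝ)⁻¹ * ∑ i, condInfoTilde G (measured key i ω) := by
  simp only [condInfoTilde]
  simp_rw [hq.condEntropy_eq hω htr h, Finset.sum_add_distrib, sum_parts_split_compl hM,
    ← Finset.mul_sum, Finset.sum_sub_distrib]
  rw [Finset.sum_comm]
  simp [← Finset.mul_sum]
  ring

/-- Measuring the keys of the tensor factors in `R` one after the other: every functional of states
that is nonnegative, and that each measurement lowers on average by `c M`, is at least the sum of
the `c M`. -/
theorem sum_le_of_measured {κ : {K : Finset S // 2 ≤ K.card} → Type*} [∀ M, Fintype (κ M)]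
    [∀ M, DecidableEq (κ M)] [∀ M, Nonempty (κ M)]
    {key : ∀ M : {K : Finset S // 2 ≤ K.card}, (a : {a // a ∈ M.1}) → F M a → κ M}
    {q : ∀ M, Matrix (SlotIndex F M) (SlotIndex F M) ℂ}
    (hq : ∀ M, IsKeyProjection (key M) (q M))
    {J : Matrix (((a : S) → FactorPartyIndex F a) × E) (((a : S) → FactorPartyIndex F a) × E) ℂ → ℝ}
    {c : {K : Finset S // 2 ≤ K.card} → ℝ} (R : Finset {K : Finset S // 2 ≤ K.card})
    (h0 : ∀ ω, ω.PosSemidef → 0 ≤ J ω)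
    (hJ : ∀ M ∈ R, ∀ ω, ω.PosSemidef → ω.trace = 1 → slotOp E M (q M) * ω = ω →
      J ω = c M + (Fintype.card (κ M) : ℝ)⁻¹ * ∑ i, J (measured (key M) i ω))
    {ω} (hω : ω.PosSemidef) (htr : ω.trace = 1) (h : ∀ M ∈ R, slotOp E M (q M) * ω = ω) :
    ∑ M ∈ R, c M ≤ J ω := by
  induction R using Finset.induction_on generalizing ω with
  | empty => simpa using h0 ω hω
  | insert M R hMR ih =>
    have hN : (0 : ℝ) < Fintype.card (κ M) := by exact_mod_cast Fintype.card_pos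
    have hM := h M (Finset.mem_insert_self _ _)
    rw [Finset.sum_insert hMR, hJ M (Finset.mem_insert_self _ _) ω hω htr hM]
    have hi : ∀ i, ∑ M ∈ R, c M ≤ J (measured (key M) i ω) := by
      intro i
      refine ih (fun M' hM' => hJ M' (Finset.mem_insert_of_mem hM')) (measured_posSemidef hω i)
        ((hq M).trace_measured hω hM i |>.trans htr) fun M' hM' => ?_
      exact slotOp_mul_measured (by rintro rfl; exact hMR hM')
        (h M' (Finset.mem_insert_of_mem hM')) i
    have hsum := Finset.sum_le_sum fun i (_ : i ∈ Finset.univ) => hi i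
    rw [Finset.sum_const, Finset.card_univ, nsmul_eq_mul] at hsum
    have := mul_le_mul_of_nonneg_left hsum (inv_pos.2 hN).le
    rw [← mul_assoc, inv_mul_cancel₀ hN.ne', one_mul] at this
    linarith

end Bounds

/-! ### Extensions of tensor products -/

section TensorProduct

theorem exists_conjTranspose_mul_self_eq {n : Type*} [Fintype n] [DecidableEq n]
    {A : Matrix n n ℂ} (h : A.PosSemidef) : ∃ C : Matrix n n ℂ, A = Cᴴ * C := by
  obtain ⟨U, p, hU, hp, hA, -⟩ := exists_spectral_decomposition h
  refine ⟨Matrix.diagonal (fun i => (Real.sqrt (p i) : ℂ)) * Uᴴ, ?_⟩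
  rw [Matrix.conjTranspose_mul, Matrix.conjTranspose_conjTranspose, Matrix.diagonal_conjTranspose,
    Matrix.mul_assoc, ← Matrix.mul_assoc (Matrix.diagonal _), Matrix.diagonal_mul_diagonal,
    ← Matrix.mul_assoc, hA]
  congr 3
  ext i
  simp only [Pi.star_apply, Complex.star_def, Complex.conj_ofReal]
  rw [← Complex.ofReal_mul, Real.mul_self_sqrt (hp i)]

/-- A state that is found in the range of a projection with certainty is supported there. -/
theorem proj_mul_eq_self_of_trace_eq {n : Type*} [Fintype n] [DecidableEq n] {Q ω : Matrix n n ℂ}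
    (hQ : Qᴴ = Q) (hQQ : Q * Q = Q) (hω : ω.PosSemidef) (htr : (Q * ω).trace = ω.trace) :
    Q * ω = ω := by
  obtain ⟨C, rfl⟩ := exists_conjTranspose_mul_self_eq hω
  have h1 : (1 - Q)ᴴ = 1 - Q := by rw [Matrix.conjTranspose_sub, Matrix.conjTranspose_one, hQ]
  have h2 : (1 - Q) * (1 - Q) = 1 - Q := by
    simp [mul_sub, sub_mul, hQQ]
  have h0 : ((C * (1 - Q))ᴴ * (C * (1 - Q))).trace = 0 := by
    rw [Matrix.conjTranspose_mul, h1, ← Matrix.mul_assoc, Matrix.trace_mul_comm,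
      ← Matrix.mul_assoc, ← Matrix.mul_assoc, h2, Matrix.mul_assoc, Matrix.sub_mul,
      Matrix.one_mul, Matrix.trace_sub, htr, sub_self]
  have h3 : C * (1 - Q) = 0 := Matrix.trace_conjTranspose_mul_self_eq_zero_iff.1 h0
  have h4 : C = C * Q := by
    rw [Matrix.mul_sub, Matrix.mul_one, sub_eq_zero] at h3
    exact h3
  have h5 : Q * Cᴴ = Cᴴ := by
    have := congrArg Matrix.conjTranspose h4
    rw [Matrix.conjTranspose_mul, hQ] at this
    exact this.symm
  rw [← Matrix.mul_assoc, h5]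

/-- A tensor product of states is a state. -/
theorem isState_tensor {ι : Type*} [Fintype ι] [DecidableEq ι] {n : ι → Type*}
    [∀ i, Fintype (n i)] [∀ i, DecidableEq (n i)] {A : ∀ i, Matrix (n i) (n i) ℂ}
    (hA : ∀ i, IsState (A i)) :
    IsState (Matrix.of fun x y : ∀ i, n i => ∏ i, A i (x i) (y i)) := by
  choose C hC using fun i => exists_conjTranspose_mul_self_eq (hA i).posSemidef
  constructor
  · have : (Matrix.of fun x y : ∀ i, n i => ∏ i, A i (x i) (y i))
        = (Matrix.of fun x y : ∀ i, n i => ∏ i, C i (x i) (y i))ᴴ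
          * (Matrix.of fun x y : ∀ i, n i => ∏ i, C i (x i) (y i)) := by
      ext x y
      simp only [Matrix.of_apply, Matrix.mul_apply, Matrix.conjTranspose_apply, star_prod,
        ← Finset.prod_mul_distrib]
      refine Eq.trans ?_ (Fintype.prod_sum fun i u => star (C i u (x i)) * C i u (y i))
      refine Finset.prod_congr rfl fun i _ => ?_
      rw [hC i, Matrix.mul_apply]
      rfl
    rw [this]
    exact Matrix.posSemidef_conjTranspose_mul_self _
  · simp only [Matrix.trace, Matrix.diag_apply, Matrix.of_apply]
    refine (Fintype.prod_sum fun i u => A i u u).symm.trans ?_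
    exact Finset.prod_eq_one fun i _ => (hA i).trace_eq_one

variable {S : Type*} [Fintype S] [DecidableEq S] {F : Finset S → S → Type*}
  [∀ K a, Fintype (F K a)] [∀ K a, DecidableEq (F K a)] {E : Type*} [Fintype E] [DecidableEq E]

/-- The tensor product of states of the tensor factors, as a state of the parties. -/
def factorTensor (ψ : ∀ M, Matrix (SlotIndex F M) (SlotIndex F M) ℂ) :
    Matrix ((a : S) → FactorPartyIndex F a) ((a : S) → FactorPartyIndex F a) ℂ :=
  Matrix.of fun x y => ∏ M, ψ M (slot M x) (slot M y)

theorem isState_factorTensor {ψ : ∀ M, Matrix (SlotIndex F M) (SlotIndex F M) ℂ}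
    (hψ : ∀ M, IsState (ψ M)) : IsState (factorTensor ψ) := by
  have h := isState_tensor hψ
  have heq : factorTensor ψ = (Matrix.of fun x y : ∀ M, SlotIndex F M =>
      ∏ M, ψ M (x M) (y M)).submatrix (slotEquiv F) (slotEquiv F) := rfl
  refine ⟨heq ▸ h.posSemidef.submatrix _, ?_⟩
  rw [heq, ← h.trace_eq_one]
  simp only [Matrix.trace, Matrix.diag_apply, Matrix.submatrix_apply]
  exact (slotEquiv F).sum_comp fun u => (Matrix.of fun x y : ∀ M, SlotIndex F M =>
      ∏ M, ψ M (x M) (y M)) u u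

/-- An operator on one tensor factor that fixes its state fixes the tensor product. -/
theorem sum_slot_mul_factorTensor {ψ : ∀ M, Matrix (SlotIndex F M) (SlotIndex F M) ℂ}
    {M : {K : Finset S // 2 ≤ K.card}} {q : Matrix (SlotIndex F M) (SlotIndex F M) ℂ}
    (hq : q * ψ M = ψ M) (x z : (a : S) → FactorPartyIndex F a) :
    ∑ y, (if ∀ K, K ≠ M → slot K x = slot K y then q (slot M x) (slot M y) else 0)
      * factorTensor ψ y z = factorTensor ψ x z := by
  have hinj : Function.Injective fun u : SlotIndex F M =>
      (slotEquiv F).symm (Function.update (slotEquiv F x) M u) :=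
    (slotEquiv F).symm.injective.comp (Function.update_injective _ M)
  have hslot : ∀ (u : SlotIndex F M) K, slot K ((slotEquiv F).symm
      (Function.update (slotEquiv F x) M u)) = Function.update (slotEquiv F x) M u K := by
    intro u K
    rfl
  rw [← Fintype.sum_of_injective _ hinj (fun u => q (slot M x) u * (ψ M u (slot M z)
    * ∏ K : {K // K ≠ M}, ψ K (slot K.1 x) (slot K.1 z))) _ ?_ ?_]
  · simp only [← mul_assoc, ← Finset.sum_mul]
    rw [← Matrix.mul_apply, hq, factorTensor, Matrix.of_apply,
      Fintype.prod_eq_mul_prod_subtype_ne _ M]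
  · intro y hy
    rw [if_neg, zero_mul]
    intro h
    refine hy ⟨slot M y, ?_⟩
    rw [Equiv.symm_apply_eq]
    funext K
    by_cases hK : K = M
    · subst hK
      rw [Function.update_self]
      rfl
    · rw [Function.update_of_ne hK]
      exact h K hK
  · intro u
    rw [if_pos]
    · rw [hslot, Function.update_self, factorTensor, Matrix.of_apply,
        Fintype.prod_eq_mul_prod_subtype_ne _ M, hslot, Function.update_self]
      congr 2
      refine Finset.prod_congr rfl fun K _ => ?_
      rw [hslot, Function.update_of_ne K.2]
      rfl
    · intro K hK
      rw [hslot, Function.update_of_ne hK]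
      rfl

theorem IsKeyProjection.mul_self {M : {K : Finset S // 2 ≤ K.card}} {ι : Type*} [Fintype ι]
    [DecidableEq ι] [Nonempty ι] {key : (a : {a // a ∈ M.1}) → F M a → ι}
    {q : Matrix (SlotIndex F M) (SlotIndex F M) ℂ} (hq : IsKeyProjection key q) : q * q = q := by
  have hN : (Fintype.card ι : ℝ) ≠ 0 := by exact_mod_cast Fintype.card_ne_zero
  have h : q * q = q * ((∑ i, keyProj key i) * q) := by rw [hq.sum_mul]
  rw [h, ← Matrix.mul_assoc, Finset.mul_sum, Finset.sum_mul]
  simp_rw [hq.mul_keyProj_mul]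
  rw [Finset.sum_const, Finset.card_univ, ← Nat.cast_smul_eq_nsmul ℝ, smul_smul,
    mul_inv_cancel₀ hN, one_smul]

/-- An extension of a tensor product is supported on the range of every projection that fixes one
of the factors. -/
theorem IsExtension.slotOp_mul {ψ : ∀ M, Matrix (SlotIndex F M) (SlotIndex F M) ℂ}
    (hψ : ∀ M, IsState (ψ M)) {M : {K : Finset S // 2 ≤ K.card}}
    {q : Matrix (SlotIndex F M) (SlotIndex F M) ℂ} (hq : q * ψ M = ψ M) (hqs : qᴴ = q)
    (hqq : q * q = q)
    {ω : Matrix (((a : S) → FactorPartyIndex F a) × E) (((a : S) → FactorPartyIndex F a) × E) ℂ}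
    (hω : IsExtension (factorTensor ψ) ω) : slotOp E M q * ω = ω := by
  refine proj_mul_eq_self_of_trace_eq (by rw [← slotOp_conjTranspose, hqs])
    (by rw [← Squashed.slotOp_mul, hqq]) hω.isState.posSemidef ?_
  rw [hω.isState.trace_eq_one, ← (isState_factorTensor hψ).trace_eq_one]
  simp only [Matrix.trace, Matrix.diag_apply, Matrix.mul_apply, Fintype.sum_prod_type]
  refine Finset.sum_congr rfl fun x _ => ?_
  rw [← sum_slot_mul_factorTensor hq x x, Finset.sum_comm]
  refine Finset.sum_congr rfl fun y _ => ?_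
  rw [← hω.trace_E y x, Finset.mul_sum]
  refine Finset.sum_congr rfl fun e _ => ?_
  rw [Finset.sum_eq_single e]
  · simp [slotOp_apply]
  · intro f _ hf
    simp [slotOp_apply, hf.symm]
  · simp

end TensorProduct

/-! ### Private states -/

section Private

variable {P : Type*} [Fintype P] [DecidableEq P] {d k : ℕ} {s : P → ℕ}

theorem ghzVector_apply [Nonempty P] (x : P → Fin d) :
    ghzVector P d x = ((1 / Real.sqrt d : ℝ) : ℂ) * (if ∃ i, ∀ a, x a = i then 1 else 0) := by
  obtain ⟨a₀⟩ := ‹Nonempty P›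
  rw [ghzVector]
  congr 1
  have h : ∀ i : Fin d, (∏ a, (Pi.single i 1 : Fin d → ℂ) (x a))
      = if ∀ a, x a = i then 1 else 0 := by
    intro i
    simp only [Pi.single_apply]
    split_ifs with h
    · exact Finset.prod_eq_one fun a _ => if_pos (h a)
    · obtain ⟨a, ha⟩ := not_forall.1 h
      exact Finset.prod_eq_zero (Finset.mem_univ a) (if_neg ha)
  simp_rw [h]
  split_ifs with hx
  · obtain ⟨i, hi⟩ := hx
    rw [Finset.sum_eq_single i]
    · exact if_pos hi
    · intro j _ hj
      exact if_neg fun h => hj ((h a₀).symm.trans (hi a₀))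
    · simp
  · exact Finset.sum_eq_zero fun i _ => if_neg fun h => hx ⟨i, h⟩

theorem ghz_apply [Nonempty P] (x y : P → Fin d) :
    ghz P d x y = ((d : ℝ)⁻¹ : ℝ) * (if ∃ i, ∀ a, x a = i then 1 else 0)
      * (if ∃ i, ∀ a, y a = i then 1 else 0) := by
  have hd : ((1 / Real.sqrt d : ℝ) : ℂ) * ((1 / Real.sqrt d : ℝ) : ℂ) = ((d : ℝ)⁻¹ : ℝ) := by
    rw [← Complex.ofReal_mul, one_div, ← mul_inv, Real.mul_self_sqrt (Nat.cast_nonneg d)]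
  rw [ghz, Matrix.vecMulVec_apply, Pi.star_apply, ghzVector_apply, ghzVector_apply, star_mul', ← hd,
    Complex.star_def, Complex.conj_ofReal, apply_ite (starRingEnd ℂ), map_one, map_zero]
  ring

theorem twisting_mul_kronecker_mul_apply {ι σ : Type*} [Fintype ι] [DecidableEq ι] [Fintype σ]
    (U : ι → Matrix σ σ ℂ) (A : Matrix ι ι ℂ) (ρ : Matrix σ σ ℂ) (c c' : ι) (t t' : σ) :
    (twisting U * (A ⊗ₖ ρ) * (twisting U)ᴴ) (c, t) (c', t')
      = A c c' * (U c * ρ * (U c')ᴴ) t t' := by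
  have h1 : ∀ r : ι × σ, (twisting U * (A ⊗ₖ ρ)) (c, t) r = A c r.1 * (U c * ρ) t r.2 := by
    intro r
    rw [Matrix.mul_apply, Fintype.sum_prod_type, Finset.sum_eq_single c]
    · rw [Matrix.mul_apply, Finset.mul_sum]
      refine Finset.sum_congr rfl fun x _ => ?_
      simp only [twisting, Matrix.of_apply, if_true, Matrix.kroneckerMap_apply]
      ring
    · intro b _ hb
      simp [twisting, hb.symm]
    · simp
  rw [Matrix.mul_apply, Fintype.sum_prod_type, Finset.sum_eq_single c']
  · rw [Matrix.mul_apply, Finset.mul_sum]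
    refine Finset.sum_congr rfl fun x _ => ?_
    rw [h1]
    simp only [twisting, Matrix.of_apply, if_true, Matrix.conjTranspose_apply]
    ring
  · intro b _ hb
    simp [twisting, hb.symm]
  · simp

/-- The isometry, up to a factor, that prepares `Φ_d ⊗ γ` out of the shield state: it maps `|φ⟩` to
`∑_{i,j} |i…i⟩ ⊗ |j…j⟩ ⊗ U^{j…j}|φ⟩`. -/
def prepare (d : ℕ) (U : (P → Fin k) → Matrix ((a : P) → Fin (s a)) ((a : P) → Fin (s a)) ℂ) :
    Matrix ((a : P) → Fin d × Fin k × Fin (s a)) ((a : P) → Fin (s a)) ℂ :=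
  Matrix.of fun u t => if ∃ i : Fin d × Fin k, ∀ a, ((u a).1, (u a).2.1) = i then
    U (fun a => (u a).2.1) (fun a => (u a).2.2) t else 0

theorem sum_diagonal_mul_prepare [Nonempty P]
    (U : (P → Fin k) → Matrix ((a : P) → Fin (s a)) ((a : P) → Fin (s a)) ℂ) :
    (∑ i : Fin d × Fin k, Matrix.diagonal fun u : (a : P) → Fin d × Fin k × Fin (s a) =>
      if ∀ a, ((u a).1, (u a).2.1) = i then (1 : ℂ) else 0) * prepare d U = prepare d U := by
  obtain ⟨a₀⟩ := ‹Nonempty P›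
  ext u t
  rw [Matrix.sum_mul, Matrix.sum_apply]
  simp only [Matrix.diagonal_mul, prepare, Matrix.of_apply]
  by_cases h : ∃ i : Fin d × Fin k, ∀ a, ((u a).1, (u a).2.1) = i
  · obtain ⟨i, hi⟩ := h
    rw [Finset.sum_eq_single i]
    · rw [if_pos hi, one_mul]
    · intro j _ hj
      rw [if_neg, zero_mul]
      exact fun h => hj ((h a₀).symm.trans (hi a₀))
    · simp
  · simp only [if_neg h, mul_zero, Finset.sum_const_zero]

theorem prepare_conjTranspose_mul_diagonal_mul
    {U : (P → Fin k) → Matrix ((a : P) → Fin (s a)) ((a : P) → Fin (s a)) ℂ}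
    (hU : ∀ i, U i ∈ Matrix.unitaryGroup ((a : P) → Fin (s a)) ℂ) (i : Fin d × Fin k) :
    (prepare d U)ᴴ * (Matrix.diagonal fun u : (a : P) → Fin d × Fin k × Fin (s a) =>
      if ∀ a, ((u a).1, (u a).2.1) = i then (1 : ℂ) else 0) * prepare d U = 1 := by
  ext t t'
  rw [Matrix.mul_apply]
  have hinj : Function.Injective fun (v : (a : P) → Fin (s a)) (a : P) => (i.1, i.2, v a) := by
    intro v w h
    funext a
    exact (Prod.ext_iff.1 (Prod.ext_iff.1 (congrFun h a)).2).2
  rw [← Fintype.sum_of_injective _ hinj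
    (fun v => star (U (fun _ => i.2) v t) * U (fun _ => i.2) v t') _ ?_ ?_]
  · have h := Matrix.mem_unitaryGroup_iff'.1 (hU fun _ => i.2)
    rw [← h, Matrix.mul_apply]
    rfl
  · intro u hu
    rw [Matrix.mul_diagonal, if_neg, mul_zero, zero_mul]
    intro h
    refine hu ⟨fun a => (u a).2.2, ?_⟩
    funext a
    rw [← h a]
  · intro v
    have h1 : ∀ a : P, (((i.1, i.2, v a) : Fin d × Fin k × Fin (s a)).1,
        ((i.1, i.2, v a) : Fin d × Fin k × Fin (s a)).2.1) = i := fun _ => rfl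
    rw [Matrix.mul_diagonal, if_pos h1, mul_one, Matrix.conjTranspose_apply, prepare,
      Matrix.of_apply, Matrix.of_apply, if_pos ⟨i, h1⟩, if_pos ⟨i, h1⟩]

theorem prepare_apply (U : (P → Fin k) → Matrix ((a : P) → Fin (s a)) ((a : P) → Fin (s a)) ℂ)
    (u : (a : P) → Fin d × Fin k × Fin (s a)) (t : (a : P) → Fin (s a)) :
    prepare d U u t
      = (if ∃ i, ∀ a, (u a).1 = i then 1 else 0) * (if ∃ i, ∀ a, (u a).2.1 = i then 1 else 0)
        * U (fun a => (u a).2.1) (fun a => (u a).2.2) t := by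
  have h : (∃ i : Fin d × Fin k, ∀ a, ((u a).1, (u a).2.1) = i)
      ↔ (∃ i, ∀ a, (u a).1 = i) ∧ (∃ i, ∀ a, (u a).2.1 = i) := by
    constructor
    · rintro ⟨i, hi⟩
      exact ⟨⟨i.1, fun a => congrArg Prod.fst (hi a)⟩, ⟨i.2, fun a => congrArg Prod.snd (hi a)⟩⟩
    · rintro ⟨⟨i, hi⟩, ⟨j, hj⟩⟩
      exact ⟨(i, j), fun a => Prod.ext (hi a) (hj a)⟩
  rw [prepare, Matrix.of_apply, ite_zero_mul_ite_zero, one_mul, ite_mul, one_mul, zero_mul]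
  exact if_congr h rfl rfl

/-- `Φ_d ⊗ γ` is prepared from the shield state `ρ`, with its `d k` key values equally likely. -/
theorem ghz_mul_private_eq [Nonempty P] {γ : Matrix ((P → Fin k) × ((a : P) → Fin (s a)))
      ((P → Fin k) × ((a : P) → Fin (s a))) ℂ}
    {ρ : Matrix ((a : P) → Fin (s a)) ((a : P) → Fin (s a)) ℂ}
    {U : (P → Fin k) → Matrix ((a : P) → Fin (s a)) ((a : P) → Fin (s a)) ℂ}
    (hγ : γ = twisting U * (ghz P k ⊗ₖ ρ) * (twisting U)ᴴ) :
    (Matrix.of fun u v : (a : P) → Fin d × Fin k × Fin (s a) =>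
      ghz P d (fun a => (u a).1) (fun a => (v a).1) *
      γ (fun a => (u a).2.1, fun a => (u a).2.2) (fun a => (v a).2.1, fun a => (v a).2.2))
      = (Fintype.card (Fin d × Fin k) : ℝ)⁻¹ • (prepare d U * ρ * (prepare d U)ᴴ) := by
  ext u v
  have h : (prepare d U * ρ * (prepare d U)ᴴ) u v
      = (if ∃ i, ∀ a, (u a).1 = i then 1 else 0) * (if ∃ i, ∀ a, (u a).2.1 = i then 1 else 0)
        * ((if ∃ i, ∀ a, (v a).1 = i then 1 else 0) * (if ∃ i, ∀ a, (v a).2.1 = i then 1 else 0))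
        * (U (fun a => (u a).2.1) * ρ * (U (fun a => (v a).2.1))ᴴ)
          (fun a => (u a).2.2) (fun a => (v a).2.2) := by
    simp only [Matrix.mul_apply, Matrix.conjTranspose_apply, prepare_apply, star_mul',
      apply_ite (star : ℂ → ℂ), star_one, star_zero, Finset.mul_sum, Finset.sum_mul]
    refine Finset.sum_congr rfl fun x _ => Finset.sum_congr rfl fun y _ => ?_
    ring
  rw [Matrix.of_apply, hγ, twisting_mul_kronecker_mul_apply, ghz_apply, ghz_apply,
    Matrix.smul_apply, h, Fintype.card_prod, Fintype.card_fin, Fintype.card_fin]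
  rw [Complex.real_smul]
  push_cast
  rw [mul_inv]
  ring

end Private

/-! ### The tensor factors of the state `Ψ_S` -/

section Main

variable {S : Type*} [Fintype S] [DecidableEq S] {d k : Finset S → ℕ} {s : Finset S → S → ℕ}

/-- The basis index set of the systems of the party `a` in `Φ_K ⊗ γ_K`. -/
abbrev FactorIndex (d k : Finset S → ℕ) (s : Finset S → S → ℕ) (K : Finset S) (a : S) : Type :=
  Fin (d K) × Fin (k K) × Fin (s K a)

/-- The key of the party `a` in `Φ_M ⊗ γ_M`: its part of the GHZ state and its key system. -/
def factorKey (M : {K : Finset S // 2 ≤ K.card}) (a : {a // a ∈ M.1})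
    (u : FactorIndex d k s M a) : Fin (d M) × Fin (k M) :=
  (u.1, u.2.1)

/-- The state `Φ_M ⊗ γ_M`. -/
def factorState (γ : (K : Finset S) →
      Matrix (({a // a ∈ K} → Fin (k K)) × ((a : {a // a ∈ K}) → Fin (s K a)))
        (({a // a ∈ K} → Fin (k K)) × ((a : {a // a ∈ K}) → Fin (s K a))) ℂ)
    (M : {K : Finset S // 2 ≤ K.card}) :
    Matrix (SlotIndex (FactorIndex d k s) M) (SlotIndex (FactorIndex d k s) M) ℂ :=
  Matrix.of fun u v => ghz {a // a ∈ M.1} (d M) (fun a => (u a).1) (fun a => (v a).1) *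
    γ M (fun a => (u a).2.1, fun a => (u a).2.2) (fun a => (v a).2.1, fun a => (v a).2.2)

/-- `Φ_M ⊗ γ_M` is a state of a perfect key with values in `Fin (d M) × Fin (k M)`. -/
theorem exists_isKeyProjection {γ : (K : Finset S) →
      Matrix (({a // a ∈ K} → Fin (k K)) × ((a : {a // a ∈ K}) → Fin (s K a)))
        (({a // a ∈ K} → Fin (k K)) × ((a : {a // a ∈ K}) → Fin (s K a))) ℂ}
    (M : {K : Finset S // 2 ≤ K.card}) (hd : 1 ≤ d M) (hk : 1 ≤ k M)
    (hγ : IsPrivate (k M) (fun a : {a // a ∈ M.1} => s M a) (γ M)) :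
    IsState (factorState (d := d) γ M) ∧
      ∃ q, IsKeyProjection (factorKey (d := d) (k := k) (s := s) M) q ∧
        q * factorState γ M = factorState γ M := by
  obtain ⟨ρ, U, hρ, hU, hγU⟩ := hγ
  have : Nonempty {a // a ∈ M.1} := by
    obtain ⟨a, ha⟩ := Finset.card_pos.1 (lt_of_lt_of_le two_pos M.2)
    exact ⟨⟨a, ha⟩⟩
  have hcard : 0 < Fintype.card (Fin (d M) × Fin (k M)) := by
    simpa using ⟨by omega, by omega⟩
  set N : ℝ := (Fintype.card (Fin (d M) × Fin (k M)) : ℝ) with hN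
  have hN0 : 0 < N := Nat.cast_pos.2 hcard
  set W := prepare (d M) U with hW
  have hψ : factorState γ M = N⁻¹ • (W * ρ * Wᴴ) := ghz_mul_private_eq hγU
  have hsum : (∑ i, keyProj (factorKey (d := d) (k := k) (s := s) M) i) * W = W :=
    sum_diagonal_mul_prepare U
  have hPW : ∀ i, Wᴴ * keyProj (factorKey (d := d) (k := k) (s := s) M) i * W = 1 :=
    fun i => prepare_conjTranspose_mul_diagonal_mul hU i
  have hWW : Wᴴ * W = N • 1 := by
    have h : Wᴴ * W = Wᴴ * ((∑ i, keyProj (factorKey (d := d) (k := k) (s := s) M) i) * W) := by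
      rw [hsum]
    rw [h, ← Matrix.mul_assoc, Matrix.mul_sum, Matrix.sum_mul]
    simp_rw [hPW]
    rw [Finset.sum_const, Finset.card_univ, ← Nat.cast_smul_eq_nsmul ℝ]
  refine ⟨⟨?_, ?_⟩, N⁻¹ • (W * Wᴴ), ⟨?_, ?_, ?_⟩, ?_⟩
  · rw [hψ]
    exact (hρ.posSemidef.mul_mul_conjTranspose_same W).smul (inv_pos.2 hN0).le
  · rw [hψ, Matrix.trace_smul, Matrix.trace_mul_comm, ← Matrix.mul_assoc, hWW, Matrix.smul_mul,
      Matrix.trace_smul, smul_smul, inv_mul_cancel₀ hN0.ne', one_smul, Matrix.one_mul,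
      hρ.trace_eq_one]
  · rw [Matrix.conjTranspose_smul, Matrix.conjTranspose_mul, Matrix.conjTranspose_conjTranspose,
      star_trivial]
  · rw [Matrix.mul_smul, ← Matrix.mul_assoc, hsum]
  · intro i
    rw [Matrix.smul_mul, Matrix.smul_mul, Matrix.mul_smul]
    congr 2
    have : W * Wᴴ * keyProj (factorKey (d := d) (k := k) (s := s) M) i * (W * Wᴴ)
        = W * (Wᴴ * keyProj (factorKey (d := d) (k := k) (s := s) M) i * W) * Wᴴ := by
      simp only [Matrix.mul_assoc]
    rw [this, hPW, Matrix.mul_one]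
  · rw [hψ, smul_mul_smul_comm]
    have : W * Wᴴ * (W * ρ * Wᴴ) = W * (Wᴴ * W) * ρ * Wᴴ := by
      simp only [Matrix.mul_assoc]
    rw [this, hWW, Matrix.mul_smul, Matrix.mul_one, Matrix.smul_mul, Matrix.smul_mul, smul_smul,
      mul_assoc, inv_mul_cancel₀ hN0.ne', mul_one]

/-- A state has at least one extension, so the infima in the squashed entanglements are over
nonempty sets. -/
theorem exists_isExtension {H : S → Type*} [∀ a, Fintype (H a)]
    {ρ : Matrix ((a : S) → H a) ((a : S) → H a) ℂ} (h : IsState ρ) :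
    ∃ (n : ℕ) (ω : Matrix (((a : S) → H a) × Fin n) (((a : S) → H a) × Fin n) ℂ),
      IsExtension ρ ω := by
  refine ⟨1, ρ.submatrix Prod.fst Prod.fst, ⟨h.posSemidef.submatrix _, ?_⟩, ?_⟩
  · rw [← h.trace_eq_one]
    simp [Matrix.trace, Fintype.sum_prod_type]
  · intro x y
    simp

end Main

end Squashed

end


open Squashed in
theorem mainTheorem6 {S : Type*} [Fintype S] [DecidableEq S]
    (d k : Finset S → ℕ) (s : Finset S → S → ℕ)
    (γ : (K : Finset S) →
      Matrix (({a // a ∈ K} → Fin (k K)) × ((a : {a // a ∈ K}) → Fin (s K a)))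
        (({a // a ∈ K} → Fin (k K)) × ((a : {a // a ∈ K}) → Fin (s K a))) ℂ)
    (hd : ∀ K : Finset S, 2 ≤ K.card → 1 ≤ d K)
    (hk : ∀ K : Finset S, 2 ≤ K.card → 1 ≤ k K)
    (hγ : ∀ K : Finset S, 2 ≤ K.card →
      Squashed.IsPrivate (k K) (fun a : {a // a ∈ K} => s K a) (γ K))
    (G : Finpartition (Finset.univ : Finset S)) (hG : G.parts ≠ {Finset.univ}) :
    1 / 2 * ∑ M ∈ Squashed.crossing G,
        ((Squashed.traceBlocks M G).card : ℝ) * (Real.logb 2 (k M) + Real.logb 2 (d M)) ≤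
      min (Squashed.squashed G (Squashed.bigState d k s γ))
        (Squashed.squashedTilde G (Squashed.bigState d k s γ)) := by
  have hfac := fun M : {K : Finset S // 2 ≤ K.card} =>
    exists_isKeyProjection (d := d) M (hd M M.2) (hk M M.2) (hγ M M.2)
  choose hstate q hq hqψ using hfac
  have hne : ∀ M : {K : Finset S // 2 ≤ K.card}, Nonempty (Fin (d M) × Fin (k M)) := fun M =>
    ⟨(⟨0, hd M M.2⟩, ⟨0, hk M M.2⟩)⟩
  have hbig : bigState d k s γ = factorTensor (factorState γ) := rfl
  have hbigState : IsState (bigState d k s γ) := hbig ▸ isState_factorTensor hstate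
  obtain ⟨n₀, ω₀, hω₀⟩ := exists_isExtension hbigState
  -- the crossing sets, as sets of at least two parties
  set R : Finset {K : Finset S // 2 ≤ K.card} :=
    Finset.univ.filter fun M => M.1 ∈ crossing G with hR
  have hRc : ∀ M ∈ R, M.1 ∈ crossing G := fun M hM => (Finset.mem_filter.1 hM).2
  have hsum : ∑ M ∈ crossing G,
        ((traceBlocks M G).card : ℝ) * (Real.logb 2 (k M) + Real.logb 2 (d M))
      = ∑ M ∈ R, ((traceBlocks M.1 G).card : ℝ)
        * Real.logb 2 (Fintype.card (Fin (d M) × Fin (k M))) := by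
    symm
    refine Finset.sum_bij (fun M _ => M.1) hRc (fun _ _ _ _ h => Subtype.ext h)
      (fun M hM => ⟨⟨M, (Finset.mem_filter.1 hM).2.1⟩, by simpa [hR] using hM, rfl⟩)
      fun M _ => ?_
    have h1 : (d M : ℝ) ≠ 0 := by exact_mod_cast Nat.one_le_iff_ne_zero.1 (hd M M.2)
    have h2 : (k M : ℝ) ≠ 0 := by exact_mod_cast Nat.one_le_iff_ne_zero.1 (hk M M.2)
    rw [Fintype.card_prod, Fintype.card_fin, Fintype.card_fin, Nat.cast_mul, Real.logb_mul h1 h2,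
      add_comm]
  rw [hsum]
  refine le_min ?_ ?_
  · refine mul_le_mul_of_nonneg_left (le_csInf ⟨_, n₀, ω₀, hω₀, rfl⟩ ?_) (by norm_num)
    rintro r ⟨n, ω, hω, rfl⟩
    exact sum_le_of_measured hq R (fun ω hω => condInfo_nonneg hω G)
      (fun M hM ω hω htr h => (hq M).condInfo_eq hω htr h (hRc M hM)) hω.isState.posSemidef
      hω.isState.trace_eq_one
      (fun M _ => hω.slotOp_mul hstate (hqψ M) (hq M).conjTranspose_eq (hq M).mul_self)
  · refine mul_le_mul_of_nonneg_left (le_csInf ⟨_, n₀, ω₀, hω₀, rfl⟩ ?_) (by norm_num)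
    rintro r ⟨n, ω, hω, rfl⟩
    exact sum_le_of_measured hq R (fun ω hω => condInfoTilde_nonneg hω G)
      (fun M hM ω hω htr h => (hq M).condInfoTilde_eq hω htr h (hRc M hM)) hω.isState.posSemidef
      hω.isState.trace_eq_one
      (fun M _ => hω.slotOp_mul hstate (hqψ M) (hq M).conjTranspose_eq (hq M).mul_self)
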